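/- Let $Q$ be a probability distribution on $\mathbb{R}$ with expectation $0$, variance $1/2$ and finite fourth moment $b=\int x^4\,dQ(x)$, and let $\alpha\in\mathbb{N}=\{0,1,2,\dots\}$ be fixed. For integers $n\ge m\ge 0$ let $X=X(n,m)$ be an $n\times m$ random matrix with i.i.d. complex entries whose real and imaginary parts are independent, each with distribution $Q$, and for $\mu,\nu\in\mathbb{C}$ let $$f(n,m;\mu,\nu):=\mathbb{E}\big(\det(X^*X-\mu I_m)\,\det(X^*X-\nu I_m)\big)$$ (the expectation exists; a $0\times0$ determinant is $1$). For real $t$ let $$J_\alpha(t):=\sum_{k=0}^\infty\frac{(-1)^k}{k!\,(k+\alpha)!}\Big(\frac t2\Big)^{2k+\alpha}$$ be the Bessel function of order $\alpha$, and for $x,y>0$ define the Bessel kernel $$\mathbb{J}_\alpha(x,y):=\frac{J_\alpha(\sqrt x)\,\sqrt y\,J_\alpha'(\sqrt y)-\sqrt x\,J_\alpha'(\sqrt x)\,J_\alpha(\sqrt y)}{2(x-y)},$$ extended by continuity to $x=y$. Then, for all $\mu,\nu>0$, with $n=N$ and $m=N-\alpha$ (for $N \ge \alpha$), $$\lim_{N\to\infty}\left(\frac14\,N^{-1}\Big(\frac{\mu\nu}{16N^2}\Big)^{\alpha/2}\cdot\frac{f\big(n,m;\tfrac{\mu}{4N},\tfrac{\nu}{4N}\big)}{n!\,m!}\right)=\exp(b^*)\,\mathbb{J}_\alpha(\mu,\nu),\qquad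 b^*:=2\big(b-\tfrac34\big).$$ -/

import Mathlib

open MeasureTheory ProbabilityTheory Filter Topology Matrix

/-- `X` is a random `n × m` matrix, defined on the probability space `(Ω, P)`, whose entries are
i.i.d. complex random variables whose real and imaginary parts are independent, each with
distribution `Q`. -/
structure IsComplexSampleMatrix {Ω : Type*} [MeasurableSpace Ω] (P : Measure Ω) (Q : Measure ℝ)
    {n m : ℕ} (X : Ω → Matrix (Fin n) (Fin m) ℂ) : Prop where
  measurable : ∀ i j, Measurable fun ω => X ω i j
  indep : iIndepFun (fun (p : Fin n × Fin m) (ω : Ω) => X ω p.1 p.2) P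
  indep_re_im : ∀ i j, IndepFun (fun ω => (X ω i j).re) (fun ω => (X ω i j).im) P
  law_re : ∀ i j, P.map (fun ω => (X ω i j).re) = Q
  law_im : ∀ i j, P.map (fun ω => (X ω i j).im) = Q

/-- The random variable `det (X* X - μ) det (X* X - ν)`. -/
noncomputable def charPolyProduct {Ω : Type*} {n m : ℕ} (X : Ω → Matrix (Fin n) (Fin m) ℂ)
    (μ ν : ℂ) (ω : Ω) : ℂ :=
  ((X ω)ᴴ * X ω - μ • (1 : Matrix (Fin m) (Fin m) ℂ)).det *
    ((X ω)ᴴ * X ω - ν • (1 : Matrix (Fin m) (Fin m) ℂ)).det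

/-- The second-order correlation function `f(n, m; μ, ν)` of the characteristic polynomial of the
unrescaled sample covariance matrix `X* X`. -/
noncomputable def secondOrderCorrelation {Ω : Type*} [MeasurableSpace Ω] (P : Measure Ω)
    {n m : ℕ} (X : Ω → Matrix (Fin n) (Fin m) ℂ) (μ ν : ℂ) : ℂ :=
  ∫ ω, charPolyProduct X μ ν ω ∂P

/-- The Bessel function of the first kind `J_α`, of order `α ∈ ℕ`, on the real line. -/
noncomputable def besselJ (α : ℕ) (t : ℝ) : ℝ :=
  ∑' k : ℕ, (-1 : ℝ) ^ k / ((k.factorial : ℝ) * ((k + α).factorial : ℝ)) * (t / 2) ^ (2 * k + α)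

/-- The quotient defining the Bessel kernel, meaningful for `x ≠ y`. -/
noncomputable def besselKernelQuotient (α : ℕ) (x y : ℝ) : ℝ :=
  (besselJ α √x * (√y * deriv (besselJ α) √y) - √x * deriv (besselJ α) √x * besselJ α √y) /
    (2 * (x - y))

/-- The Bessel kernel `𝕁_α(x, y)` for `x, y > 0`. On the diagonal it is the continuous extension
of the quotient, which is `(g' h - h' g) / 2` at `x` for `g s = J_α(√s)` and
`h s = √s J_α'(√s)`; see `tendsto_besselKernelQuotient`. -/
noncomputable def besselKernel (α : ℕ) (x y : ℝ) : ℝ :=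
  if x = y then
    (deriv (fun s => besselJ α √s) x * (√x * deriv (besselJ α) √x) -
      deriv (fun s => √s * deriv (besselJ α) √s) x * besselJ α √x) / 2
  else besselKernelQuotient α x y

/-- The scaling factor `Z_N(μ, ν) = (μ ν / N²)^(α / 2)`. -/
noncomputable def scalingZ (α N : ℕ) (μ ν : ℝ) : ℝ :=
  (μ * ν / (N : ℝ) ^ 2) ^ ((α : ℝ) / 2)

theorem contDiff_besselJ (α : ℕ) : ContDiff ℝ 2 (besselJ α) := by
  set c : ℕ → ℝ := fun k => (-1 : ℝ) ^ k / ((k.factorial : ℝ) * ((k + α).factorial : ℝ)) with hc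
  have hr : (FormalMultilinearSeries.ofScalars ℝ c).radius = ⊤ := by
    apply FormalMultilinearSeries.ofScalars_radius_eq_top_of_tendsto
    · filter_upwards with k
      simp only [hc]
      positivity
    · have h : ∀ k : ℕ, ‖c k.succ‖ / ‖c k‖ = 1 / ((k : ℝ) + 1) * (1 / ((k : ℝ) + α + 1)) := by
        intro k
        have h1 : ((k.succ).factorial : ℝ) = (k + 1) * k.factorial := by
          rw [Nat.factorial_succ]; push_cast; ring
        have h2 : ((k.succ + α).factorial : ℝ) = (k + α + 1) * (k + α).factorial := by
          rw [show k.succ + α = (k + α) + 1 by omega, Nat.factorial_succ]; push_cast; ring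
        simp only [hc, norm_div, norm_pow, norm_neg, norm_one, one_pow, h1, h2, norm_mul,
          Real.norm_natCast]
        have h3 : (0 : ℝ) ≤ (k : ℝ) + 1 := by positivity
        have h4 : (0 : ℝ) ≤ (k : ℝ) + α + 1 := by positivity
        rw [Real.norm_of_nonneg h3, Real.norm_of_nonneg h4]
        have h5 : (k.factorial : ℝ) ≠ 0 := by positivity
        have h6 : ((k + α).factorial : ℝ) ≠ 0 := by positivity
        field_simp
      simp_rw [h]
      have h0 : Tendsto (fun k : ℕ => 1 / ((k : ℝ) + 1)) atTop (𝓝 0) :=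
        tendsto_one_div_add_atTop_nhds_zero_nat
      have h1 : Tendsto (fun k : ℕ => 1 / ((k : ℝ) + α + 1)) atTop (𝓝 0) := by
        have := h0.comp (tendsto_add_atTop_nat α)
        refine this.congr fun k => ?_
        simp
      simpa using h0.mul h1
  have hφ : ContDiff ℝ 2 (FormalMultilinearSeries.ofScalars ℝ c).sum := by
    have h := (FormalMultilinearSeries.ofScalars ℝ c).hasFPowerSeriesOnBall (by rw [hr]; simp)
    have h' := h.analyticOnNhd
    rw [hr] at h'
    rw [← contDiffOn_univ]
    have : Metric.eball (0 : ℝ) ⊤ = Set.univ := by simp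
    rw [this] at h'
    exact h'.contDiffOn uniqueDiffOn_univ
  have hJ : besselJ α = fun t => (t / 2) ^ α *
      (FormalMultilinearSeries.ofScalars ℝ c).sum ((t / 2) ^ 2) := by
    funext t
    rw [besselJ, FormalMultilinearSeries.sum, ← tsum_mul_left]
    refine tsum_congr fun k => ?_
    rw [FormalMultilinearSeries.ofScalars_apply_eq]
    simp only [hc, smul_eq_mul]
    generalize t / 2 = u
    ring
  rw [hJ]
  fun_prop

theorem tendsto_slope_of_hasStrictDerivAt {g : ℝ → ℝ} {g' x : ℝ} (hg : HasStrictDerivAt g g' x) :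
    Tendsto (fun p : ℝ × ℝ => (g p.1 - g p.2) / (p.1 - p.2))
      (𝓝[{p : ℝ × ℝ | p.1 ≠ p.2}] (x, x)) (𝓝 g') := by
  have h := ((hasStrictDerivAt_iff_hasStrictFDerivAt.1 hg).isLittleO.mono
    (nhdsWithin_le_nhds (s := {p : ℝ × ℝ | p.1 ≠ p.2}))).tendsto_div_nhds_zero
  have h2 := h.add_const g'
  rw [zero_add] at h2
  refine h2.congr' ?_
  filter_upwards [self_mem_nhdsWithin] with p hp
  have hp' : p.1 - p.2 ≠ 0 := sub_ne_zero.2 hp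
  simp
  field_simp
  ring

/-- At the diagonal, `besselKernel` is the limit of the off-diagonal quotient. -/
theorem tendsto_besselKernelQuotient (α : ℕ) {x : ℝ} (hx : 0 < x) :
    Tendsto (fun p : ℝ × ℝ => besselKernelQuotient α p.1 p.2)
      (𝓝[{p : ℝ × ℝ | p.1 ≠ p.2}] (x, x)) (𝓝 (besselKernel α x x)) := by
  have hsq : ContDiffAt ℝ 1 Real.sqrt x := Real.contDiffAt_sqrt hx.ne'
  have hJ := contDiff_besselJ α
  have hJ' : ContDiff ℝ 1 (deriv (besselJ α)) := by
    have h2 : ContDiff ℝ (1 + 1) (besselJ α) := by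
      rw [one_add_one_eq_two]; exact hJ
    exact (contDiff_succ_iff_deriv.1 h2).2.2
  have hgc : ContDiffAt ℝ 1 (fun s => besselJ α √s) x :=
    (hJ.of_le (by norm_num)).contDiffAt.comp x hsq
  have hhc : ContDiffAt ℝ 1 (fun s => √s * deriv (besselJ α) √s) x :=
    hsq.mul (hJ'.contDiffAt.comp x hsq)
  have hg := tendsto_slope_of_hasStrictDerivAt (hgc.hasStrictDerivAt (by norm_num))
  have hh := tendsto_slope_of_hasStrictDerivAt (hhc.hasStrictDerivAt (by norm_num))
  have hsnd : Tendsto (fun p : ℝ × ℝ => p.2) (𝓝[{p : ℝ × ℝ | p.1 ≠ p.2}] (x, x)) (𝓝 x) :=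
    (continuous_snd.tendsto (x, x)).mono_left nhdsWithin_le_nhds
  have hg2 := hgc.continuousAt.tendsto.comp hsnd
  have hh2 := hhc.continuousAt.tendsto.comp hsnd
  have key := ((hg.mul hh2).sub (hh.mul hg2)).div_const 2
  rw [besselKernel, if_pos rfl]
  refine key.congr' ?_
  filter_upwards [self_mem_nhdsWithin] with p hp
  have hp' : p.1 - p.2 ≠ 0 := sub_ne_zero.2 hp
  simp only [besselKernelQuotient, Function.comp]
  field_simp
  ring

/-! ### Gram determinants and the quadratic form of an added column. -/

section GramDeterminant

variable {R S : Type*} [Fintype R] [Fintype S] [DecidableEq R] [DecidableEq S]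

/-! Expanding both determinants in principal minors gives det(X*X − z) = Σ_S (−z)^(m−|S|) G(S),
where G(S) is the Gram determinant of the columns in S; so f is a combination of the expectations
E[G(S) G(S')]. Given the other columns, G(S ∪ {s}) is a quadratic form in column s, and its matrix C
(`gramForm`) is G(S) times the orthogonal projection onto the complement of the span of S. Hence tr
C = (n − |S|) G(S), C² = G(S) C, and C_ii is the Gram determinant with row i deleted. A column lying
in only one of S, S' integrates to tr C. A shared column integrates to (tr C)² + tr C² + c Σ C_ii²,
where c = 2(b − 3/4) is the fourth cumulant of an entry. This is a recursion for E[G(S)²] in the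
numbers of columns and rows (`integral_gramMinor_insert_sq`), solved by Pascal's rule
(`gramMoment_mul_factorial`).

So f/(n! m!) is a sum over (q, a, b, e), with q the power of c, a = |S \ S'|, b = |S' \ S| and e the
number of columns in neither set (`secondOrderCorrelation_div_eq_tsum`). At z = x/N, w = y/N, after
division by N^(α+1), a term has order N^(−e), so dominated convergence leaves e = 0
(`tendsto_tsum_correlationTerm`). The sum over q is exp(c); the sum over a, b is the double series Σ
β_j β_k x^j y^k / (α+j+k+1) in the Bessel coefficients β (`tsum_correlationCoeff`). The recurrence
of β, which is Bessel's equation, identifies this series with the Bessel kernel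
(`bessel_wronskian_eq`, `besselKernel_eq`). -/

/-- The Gram determinant `det (Yᴴ Y)` of the columns of `Y`. -/
noncomputable def gramDet (Y : Matrix R S ℂ) : ℂ := (Yᴴ * Y).det

/-- The matrix of the quadratic form that sends `v` to the Gram determinant of the columns of `Y`
together with `v`. -/
noncomputable def gramForm (Y : Matrix R S ℂ) : Matrix R R ℂ :=
  gramDet Y • (1 : Matrix R R ℂ) - Y * (Yᴴ * Y).adjugate * Yᴴ

-- With M = Y adj(Y*Y), the product M*M contains Y*Y adj(Y*Y) = det · 1 = 0, and M*M = 0 forces M =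
-- 0. This makes `gramForm` vanish for dependent columns, so degenerate cases need no density
-- argument.
omit [DecidableEq R] in
open scoped ComplexOrder in
theorem mul_adjugate_eq_zero_of_gramDet_eq_zero {Y : Matrix R S ℂ} (h : gramDet Y = 0) :
    Y * (Yᴴ * Y).adjugate = 0 := by
  rw [← conjTranspose_mul_self_eq_zero, conjTranspose_mul, Matrix.mul_assoc, ← Matrix.mul_assoc Yᴴ,
    mul_adjugate]
  rw [gramDet] at h
  simp [h]

theorem gramForm_eq_zero {Y : Matrix R S ℂ} (h : gramDet Y = 0) : gramForm Y = 0 := by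
  rw [gramForm, mul_adjugate_eq_zero_of_gramDet_eq_zero h, h]
  simp

omit [DecidableEq R] in
open scoped ComplexOrder in
theorem exists_mulVec_eq_zero_of_gramDet_eq_zero {Y : Matrix R S ℂ} (h : gramDet Y = 0) :
    ∃ u ≠ 0, Y *ᵥ u = 0 := by
  obtain ⟨u, hu, hu'⟩ := exists_mulVec_eq_zero_iff.2 h
  refine ⟨u, hu, ?_⟩
  rwa [conjTranspose_mul_self_mulVec_eq_zero] at hu'

omit [DecidableEq R] in
theorem gramDet_eq_zero_of_mulVec_eq_zero {Y : Matrix R S ℂ} {u : S → ℂ} (hu : u ≠ 0)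
    (h : Y *ᵥ u = 0) : gramDet Y = 0 := by
  refine exists_mulVec_eq_zero_iff.1 ⟨u, hu, ?_⟩
  rw [← mulVec_mulVec, h, mulVec_zero]

/-- Adding a column to a Gram determinant. -/
theorem gramDet_fromCols (Y : Matrix R S ℂ) (v : R → ℂ) :
    gramDet (fromCols Y (replicateCol Unit v)) = star v ⬝ᵥ gramForm Y *ᵥ v := by
  by_cases h : gramDet Y = 0
  · obtain ⟨u, hu, hu'⟩ := exists_mulVec_eq_zero_of_gramDet_eq_zero h
    rw [gramForm_eq_zero h, zero_mulVec, dotProduct_zero]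
    refine gramDet_eq_zero_of_mulVec_eq_zero (u := Sum.elim u 0) ?_ ?_
    · intro h0
      exact hu (funext fun i => congrFun h0 (Sum.inl i))
    · rw [fromCols_mulVec]
      simpa using hu'
  -- Independent columns: the Schur complement of the block YᴴY is a scalar, and multiplying by the
  -- determinant clears its inverse.
  · have hG : IsUnit (Yᴴ * Y).det := (Ne.isUnit h)
    let _ := invertibleOfIsUnitDet _ hG
    rw [gramDet, conjTranspose_fromCols_eq_fromRows_conjTranspose, fromRows_mul_fromCols,
      det_fromBlocks₁₁, det_unique (n := Unit)]
    rw [gramForm, sub_mulVec, dotProduct_sub, smul_mulVec, one_mulVec, dotProduct_smul]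
    simp only [Matrix.sub_apply]
    rw [mul_sub]
    congr 1
    · rw [invOf_eq_nonsing_inv, inv_def, Ring.inverse_eq_inv']
      have e : (replicateCol Unit v)ᴴ * Y * ((Yᴴ * Y).det⁻¹ • (Yᴴ * Y).adjugate) *
          (Yᴴ * replicateCol Unit v) = (Yᴴ * Y).det⁻¹ • ((replicateCol Unit v)ᴴ *
            (Y * (Yᴴ * Y).adjugate * Yᴴ) * replicateCol Unit v) := by
        simp only [Matrix.mul_smul, Matrix.smul_mul, Matrix.mul_assoc]
      have hd : (Yᴴ * Y).det * (Yᴴ * Y).det⁻¹ = 1 := mul_inv_cancel₀ h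
      rw [e, Matrix.smul_apply, smul_eq_mul, ← mul_assoc, hd, one_mul, Matrix.mul_assoc, mul_apply,
        dotProduct]
      refine Finset.sum_congr rfl fun i _ => ?_
      congr 1

theorem trace_gramForm (Y : Matrix R S ℂ) :
    (gramForm Y).trace = ((Fintype.card R : ℂ) - Fintype.card S) * gramDet Y := by
  rw [gramForm, trace_sub, trace_smul, trace_one, Matrix.mul_assoc, trace_mul_comm,
    Matrix.mul_assoc, adjugate_mul, trace_smul, trace_one]
  simp only [gramDet, smul_eq_mul]
  ring

/-- Reflects that `gramForm Y` is `gramDet Y` times a projection; the adjugate proves it without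
inverting YᴴY. -/
theorem gramForm_mul_self (Y : Matrix R S ℂ) : gramForm Y * gramForm Y = gramDet Y • gramForm Y := by
  have h : Y * (Yᴴ * Y).adjugate * Yᴴ * (Y * (Yᴴ * Y).adjugate * Yᴴ) =
      gramDet Y • (Y * (Yᴴ * Y).adjugate * Yᴴ) := by
    calc _ = Y * ((Yᴴ * Y).adjugate * (Yᴴ * Y)) * (Yᴴ * Y).adjugate * Yᴴ := by
          simp only [Matrix.mul_assoc]
      _ = _ := by
          rw [adjugate_mul]
          simp [gramDet]
  simp only [gramForm, sub_mul, mul_sub, h]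
  simp [smul_sub]

theorem trace_gramForm_mul_self (Y : Matrix R S ℂ) :
    (gramForm Y * gramForm Y).trace =
      ((Fintype.card R : ℂ) - Fintype.card S) * gramDet Y ^ 2 := by
  rw [gramForm_mul_self, trace_smul, trace_gramForm, smul_eq_mul]
  ring

/-- The diagonal entries of `gramForm Y` are the Gram determinants of `Y` with a row deleted. -/
theorem gramForm_diag {R' : Type*} [Fintype R'] (Y : Matrix R S ℂ) (i : R) (Y' : Matrix R' S ℂ)
    (hY' : Y'ᴴ * Y' = Yᴴ * Y + replicateCol Unit (star (Y i)) * replicateRow Unit (-Y i))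
    (hker : ∀ u, Y *ᵥ u = 0 → Y' *ᵥ u = 0) :
    gramForm Y i i = (Y'ᴴ * Y').det := by
  by_cases h : gramDet Y = 0
  · obtain ⟨u, hu, hu'⟩ := exists_mulVec_eq_zero_of_gramDet_eq_zero h
    rw [gramForm_eq_zero h]
    symm
    refine exists_mulVec_eq_zero_iff.1 ⟨u, hu, ?_⟩
    rw [← mulVec_mulVec, hker u hu', mulVec_zero]
  -- Deleting row i is a rank-one change of YᴴY, so the matrix determinant lemma applies.
  · have hG : IsUnit (Yᴴ * Y).det := (Ne.isUnit h)
    rw [hY', det_add_replicateCol_mul_replicateRow hG, det_unique (n := Unit), gramForm]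
    simp only [Matrix.sub_apply, Matrix.smul_apply, one_apply_eq, smul_eq_mul, mul_one,
      Matrix.add_apply]
    rw [mul_add, mul_one, sub_eq_add_neg, gramDet]
    congr 1
    have hd : (Yᴴ * Y).det * (Yᴴ * Y).det⁻¹ = 1 := mul_inv_cancel₀ h
    rw [inv_def, Ring.inverse_eq_inv']
    have e : replicateRow Unit (-Y i) * (Yᴴ * Y).det⁻¹ • (Yᴴ * Y).adjugate *
        replicateCol Unit (star (Y i)) = (Yᴴ * Y).det⁻¹ • (replicateRow Unit (-Y i) *
          (Yᴴ * Y).adjugate * replicateCol Unit (star (Y i))) := by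
      simp only [Matrix.mul_smul, Matrix.smul_mul]
    rw [e, Matrix.smul_apply, smul_eq_mul, ← mul_assoc, hd, one_mul, mul_apply, mul_apply,
      ← Finset.sum_neg_distrib]
    refine Finset.sum_congr rfl fun j _ => ?_
    simp [mul_apply]

end GramDeterminant

/-! ### Gram minors of a family of columns. -/

section GramMinor

variable {ι κ : Type*} [DecidableEq ι] [DecidableEq κ]

/-- The submatrix with rows `R` and columns `S` of the matrix with columns `x`. -/
def columnMinor (R : Finset κ) (S : Finset ι) (x : ι → κ → ℂ) : Matrix R S ℂ :=
  Matrix.of fun i s => x s i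

/-- The Gram determinant of the columns in `S`, restricted to the rows in `R`. -/
noncomputable def gramMinor (R : Finset κ) (S : Finset ι) (x : ι → κ → ℂ) : ℂ :=
  gramDet (columnMinor R S x)

omit [DecidableEq κ] in
theorem gramMinor_empty (R : Finset κ) (x : ι → κ → ℂ) : gramMinor R ∅ x = 1 :=
  det_isEmpty

omit [DecidableEq κ] in
theorem columnMinor_update {R : Finset κ} {S : Finset ι} {s : ι} (hs : s ∉ S) (x : ι → κ → ℂ)
    (v : κ → ℂ) : columnMinor R S (Function.update x s v) = columnMinor R S x := by
  ext i t
  have : (t : ι) ≠ s := fun h => hs (h ▸ t.2)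
  simp [columnMinor, Function.update_of_ne this]

omit [DecidableEq κ] in
theorem gramMinor_update {R : Finset κ} {S : Finset ι} {s : ι} (hs : s ∉ S) (x : ι → κ → ℂ)
    (v : κ → ℂ) : gramMinor R S (Function.update x s v) = gramMinor R S x := by
  rw [gramMinor, gramMinor, columnMinor_update hs]

theorem gramMinor_insert_update {R : Finset κ} {S : Finset ι} {s : ι} (hs : s ∉ S)
    (x : ι → κ → ℂ) (v : κ → ℂ) :
    gramMinor R (insert s S) (Function.update x s v) =
      ∑ i : R, ∑ j : R, star (v i) * gramForm (columnMinor R S x) i j * v j := by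
  let e : ↥(insert s S) ≃ S ⊕ Unit :=
    (Finset.subtypeInsertEquivOption hs).trans (Equiv.optionEquivSumPUnit _)
  have h1 : (columnMinor R (insert s S) (Function.update x s v)).submatrix id e.symm =
      fromCols (columnMinor R S x) (replicateCol Unit fun i : R => v i) := by
    ext i (t | t)
    · have : (t : ι) ≠ s := fun h => hs (h ▸ t.2)
      have h2 : ((e.symm (Sum.inl t) : ↥(insert s S)) : ι) = t := rfl
      simp [columnMinor, h2, Function.update_of_ne this]
    · have h2 : ((e.symm (Sum.inr t) : ↥(insert s S)) : ι) = s := rfl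
      simp [columnMinor, h2]
  have h3 : gramMinor R (insert s S) (Function.update x s v) =
      gramDet (fromCols (columnMinor R S x) (replicateCol Unit fun i : R => v i)) := by
    rw [← h1, gramMinor, gramDet, gramDet, ← det_submatrix_equiv_self e.symm]
    rfl
  rw [h3, gramDet_fromCols, dotProduct]
  refine Finset.sum_congr rfl fun i _ => ?_
  rw [mulVec, dotProduct, Finset.mul_sum]
  refine Finset.sum_congr rfl fun j _ => ?_
  rw [mul_assoc]
  rfl

/-- Turns the cumulant term Σ C_ii² into Gram minors with one row fewer; this is why a row set is
carried along. -/
theorem gramForm_columnMinor_diag (R : Finset κ) (S : Finset ι) (x : ι → κ → ℂ) (i : R) :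
    gramForm (columnMinor R S x) i i = gramMinor (R.erase i) S x := by
  refine gramForm_diag _ _ _ ?_ ?_
  · ext s t
    have h : ∑ j : R, star (x s j) * x t j =
        ∑ j : R.erase (i : κ), star (x s j) * x t j + star (x s i) * x t i := by
      rw [Finset.sum_coe_sort R fun j => star (x s j) * x t j,
        Finset.sum_coe_sort (R.erase (i : κ)) fun j => star (x s j) * x t j,
        Finset.sum_erase_add _ _ i.2]
    simp only [columnMinor, Matrix.add_apply, mul_apply, conjTranspose_apply, of_apply, h]
    simp
  · intro u hu
    ext j
    exact congrFun hu ⟨j, Finset.mem_of_mem_erase j.2⟩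

end GramMinor

/-! ### Expansion of the characteristic polynomial in principal minors. -/

section Expansion

variable {ι : Type*} [DecidableEq ι] [Fintype ι]

theorem det_sub_smul_one (M : Matrix ι ι ℂ) (z : ℂ) :
    (M - z • (1 : Matrix ι ι ℂ)).det = ∑ S : Finset ι, (-z) ^ (Fintype.card ι - S.card) *
      (M.submatrix (Subtype.val : S → ι) (Subtype.val : S → ι)).det := by
  have h1 : (M - z • (1 : Matrix ι ι ℂ)).det = (-1) ^ Fintype.card ι * M.charpoly.eval z := by
    rw [eval_charpoly, ← det_neg]
    congr 1
    ext i j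
    simp [Matrix.scalar_apply, Matrix.diagonal_apply, Matrix.one_apply]
  have h2 : M.charpoly.eval z = ∑ k ∈ Finset.range (Fintype.card ι + 1),
      M.charpoly.coeff (Fintype.card ι - k) * z ^ (Fintype.card ι - k) := by
    rw [Polynomial.eval_eq_sum_range, charpoly_natDegree_eq_dim,
      ← Finset.sum_range_reflect]
    simp
  rw [h1, h2, Finset.mul_sum]
  rw [← Finset.powerset_univ, Finset.sum_powerset, Finset.card_univ]
  refine Finset.sum_congr rfl fun k hk => ?_
  have hk' : k ≤ Fintype.card ι := Nat.lt_succ_iff.1 (Finset.mem_range.1 hk)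
  rw [charpoly_coeff_eq_sum_minors M k hk', Finset.mul_sum, Finset.sum_mul, Finset.mul_sum]
  refine Finset.sum_congr rfl fun S hS => ?_
  rw [(Finset.mem_powersetCard.1 hS).2]
  obtain ⟨l, hl⟩ := Nat.exists_eq_add_of_le hk'
  rw [hl, Nat.add_sub_cancel_left, neg_pow z]
  have : ((-1 : ℂ) ^ k) * (-1) ^ k = 1 := by rw [← mul_pow]; simp
  rw [pow_add]
  linear_combination ((-1) ^ l * z ^ l *
    (M.submatrix (Subtype.val : S → ι) (Subtype.val : S → ι)).det) * this

theorem det_conjTranspose_mul_self_sub {κ : Type*} [Fintype κ] [DecidableEq κ]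
    (x : ι → κ → ℂ) (z : ℂ) :
    ((Matrix.of fun i s => x s i)ᴴ * (Matrix.of fun i s => x s i) - z • (1 : Matrix ι ι ℂ)).det =
      ∑ S : Finset ι, (-z) ^ (Fintype.card ι - S.card) * gramMinor Finset.univ S x := by
  rw [det_sub_smul_one]
  refine Finset.sum_congr rfl fun S _ => ?_
  congr 1
  rw [gramMinor, gramDet]
  congr 1
  ext s t
  simp only [columnMinor, submatrix_apply, mul_apply, conjTranspose_apply, of_apply]
  rw [Finset.sum_coe_sort Finset.univ fun j => star (x s j) * x t j]

end Expansion

/-! ### Moments of the entries and of quadratic forms in a column. -/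

/-- `ρ` is a centred law on `ℂ` with unit variance, vanishing pseudo-variance, finite fourth
moment, and fourth cumulant `c`. -/
structure IsEntryLaw (ρ : Measure ℂ) (c : ℂ) : Prop where
  integrable_norm_pow : Integrable (fun z : ℂ => ‖z‖ ^ 4) ρ
  mean : ∫ z, z ∂ρ = 0
  pseudoVariance : ∫ z, z ^ 2 ∂ρ = 0
  variance : ∫ z, star z * z ∂ρ = 1
  fourth : ∫ z, star z ^ 2 * z ^ 2 ∂ρ = 2 + c

/-- The mixed moment `∫ z̄ᵃ zᵇ`. -/
noncomputable def mixedMoment (ρ : Measure ℂ) (a b : ℕ) : ℂ := ∫ z, star z ^ a * z ^ b ∂ρ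

namespace IsEntryLaw

variable {ρ : Measure ℂ} [IsProbabilityMeasure ρ] {c : ℂ}

theorem integrable_pow_mul_pow (h : IsEntryLaw ρ c) {a b : ℕ} (hab : a + b ≤ 4) :
    Integrable (fun z : ℂ => star z ^ a * z ^ b) ρ := by
  refine Integrable.mono' ((integrable_const (1 : ℝ)).add h.integrable_norm_pow)
    (by fun_prop) (Eventually.of_forall fun z => ?_)
  rw [norm_mul, norm_pow, norm_pow, norm_star, ← pow_add]
  simp only [Pi.add_apply]
  rcases le_total ‖z‖ 1 with hz | hz
  · have := pow_le_one₀ (n := a + b) (norm_nonneg z) hz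
    have : 0 ≤ ‖z‖ ^ 4 := by positivity
    linarith
  · have := pow_le_pow_right₀ hz hab
    linarith

omit [IsProbabilityMeasure ρ] in
theorem mixedMoment_swap (a b : ℕ) : mixedMoment ρ b a = star (mixedMoment ρ a b) := by
  rw [mixedMoment, mixedMoment]
  have := integral_conj (μ := ρ) (f := fun z : ℂ => star z ^ a * z ^ b)
  rw [← starRingEnd_apply, ← this]
  congr 1
  ext z
  simp [mul_comm]

theorem mixedMoment_zero_zero : mixedMoment ρ 0 0 = 1 := by simp [mixedMoment]

omit [IsProbabilityMeasure ρ] in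
theorem mixedMoment_zero_one (h : IsEntryLaw ρ c) : mixedMoment ρ 0 1 = 0 := by
  simpa [mixedMoment] using h.mean

omit [IsProbabilityMeasure ρ] in
theorem mixedMoment_zero_two (h : IsEntryLaw ρ c) : mixedMoment ρ 0 2 = 0 := by
  simpa [mixedMoment] using h.pseudoVariance

omit [IsProbabilityMeasure ρ] in
theorem mixedMoment_one_zero (h : IsEntryLaw ρ c) : mixedMoment ρ 1 0 = 0 := by
  rw [mixedMoment_swap, h.mixedMoment_zero_one, star_zero]

omit [IsProbabilityMeasure ρ] in
theorem mixedMoment_two_zero (h : IsEntryLaw ρ c) : mixedMoment ρ 2 0 = 0 := by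
  rw [mixedMoment_swap, h.mixedMoment_zero_two, star_zero]

omit [IsProbabilityMeasure ρ] in
theorem mixedMoment_one_one (h : IsEntryLaw ρ c) : mixedMoment ρ 1 1 = 1 := by
  simpa [mixedMoment] using h.variance

omit [IsProbabilityMeasure ρ] in
theorem mixedMoment_two_two (h : IsEntryLaw ρ c) : mixedMoment ρ 2 2 = 2 + c := h.fourth

variable {κ : Type*} [Fintype κ] [DecidableEq κ]

omit [IsProbabilityMeasure ρ] in
theorem prod_pow_ite (f : κ → ℂ) (i : κ) :
    ∏ p, f p ^ (if p = i then 1 else 0) = f i := by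
  simp [pow_ite]

/-- A monomial written as a product over all coordinates integrates factor by factor against the
product measure. -/
theorem pair_eq_prod (v : κ → ℂ) (i j : κ) : star (v i) * v j =
    ∏ p, (star (v p) ^ (if p = i then 1 else 0) * v p ^ (if p = j then 1 else 0)) := by
  rw [Finset.prod_mul_distrib, prod_pow_ite v, prod_pow_ite fun p => star (v p)]

theorem quad_eq_prod (v : κ → ℂ) (i j k l : κ) : star (v i) * v j * (star (v k) * v l) =
    ∏ p, (star (v p) ^ ((if p = i then 1 else 0) + (if p = k then 1 else 0)) *
      v p ^ ((if p = j then 1 else 0) + (if p = l then 1 else 0))) := by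
  simp only [pow_add, Finset.prod_mul_distrib, prod_pow_ite v, prod_pow_ite fun p => star (v p)]
  ring

theorem integrable_pair (h : IsEntryLaw ρ c) (i j : κ) :
    Integrable (fun v : κ → ℂ => star (v i) * v j) (Measure.pi fun _ => ρ) := by
  simp only [pair_eq_prod]
  refine Integrable.fintype_prod (f := fun p (z : ℂ) => star z ^ (if p = i then 1 else 0) *
    z ^ (if p = j then 1 else 0)) fun p => h.integrable_pow_mul_pow ?_
  split_ifs <;> norm_num

theorem integrable_quad (h : IsEntryLaw ρ c) (i j k l : κ) :
    Integrable (fun v : κ → ℂ => star (v i) * v j * (star (v k) * v l))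
      (Measure.pi fun _ => ρ) := by
  simp only [quad_eq_prod]
  refine Integrable.fintype_prod (f := fun p (z : ℂ) =>
    star z ^ ((if p = i then 1 else 0) + (if p = k then 1 else 0)) *
      z ^ ((if p = j then 1 else 0) + (if p = l then 1 else 0))) fun p =>
    h.integrable_pow_mul_pow ?_
  split_ifs <;> norm_num

theorem integral_pair (h : IsEntryLaw ρ c) (i j : κ) :
    ∫ v : κ → ℂ, star (v i) * v j ∂(Measure.pi fun _ => ρ) = if i = j then 1 else 0 := by
  simp only [pair_eq_prod]
  rw [integral_fintype_prod_eq_prod (f := fun p (z : ℂ) => star z ^ (if p = i then 1 else 0) *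
    z ^ (if p = j then 1 else 0))]
  change ∏ p, mixedMoment ρ (if p = i then 1 else 0) (if p = j then 1 else 0) = _
  split_ifs with hij
  · subst hij
    refine Finset.prod_eq_one fun p _ => ?_
    split_ifs
    · exact h.mixedMoment_one_one
    · exact mixedMoment_zero_zero
  · refine Finset.prod_eq_zero (Finset.mem_univ i) ?_
    simpa [hij] using h.mixedMoment_one_zero

/-- Wick pairing plus cumulant. Only pairings of a conjugated with an unconjugated factor survive,
since the pseudo-variance is zero; when all indices agree the two pairings give 2 and c supplies the
rest. Third moments never matter: an index occurring three times leaves a lone fourth one, whose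
mean is zero. -/
theorem integral_quad (h : IsEntryLaw ρ c) (i j k l : κ) :
    ∫ v : κ → ℂ, star (v i) * v j * (star (v k) * v l) ∂(Measure.pi fun _ => ρ) =
      (if i = j then if k = l then 1 else 0 else 0) +
      (if i = l then if j = k then 1 else 0 else 0) +
      (if i = j then if i = k then if k = l then c else 0 else 0 else 0) := by
  simp only [quad_eq_prod]
  rw [integral_fintype_prod_eq_prod (f := fun p (z : ℂ) =>
    star z ^ ((if p = i then 1 else 0) + (if p = k then 1 else 0)) *
      z ^ ((if p = j then 1 else 0) + (if p = l then 1 else 0)))]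
  change ∏ p, mixedMoment ρ ((if p = i then 1 else 0) + (if p = k then 1 else 0))
    ((if p = j then 1 else 0) + (if p = l then 1 else 0)) = _
  by_cases hij : i = j
  · subst hij
    by_cases hkl : k = l
    · subst hkl
      by_cases hik : i = k
      · subst hik
        rw [Finset.prod_eq_single i]
        · simp only [if_true]
          rw [h.mixedMoment_two_two]
          ring
        · intro p _ hp
          simpa [hp] using mixedMoment_zero_zero
        · simp
      · simp only [hik, if_true, if_false, add_zero]
        refine Finset.prod_eq_one fun p _ => ?_
        by_cases h1 : p = i
        · subst h1
          simpa [hik] using h.mixedMoment_one_one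
        · by_cases h2 : p = k
          · simpa [h1, h2, Ne.symm hik] using h.mixedMoment_one_one
          · simpa [h1, h2] using mixedMoment_zero_zero
    · have hz : ¬(i = l ∧ i = k) := fun ⟨h1, h2⟩ => hkl (h2.symm.trans h1)
      have : (if i = l then if i = k then (1 : ℂ) else 0 else 0) = 0 := by
        split_ifs <;> simp_all
      simp only [this, hkl, if_false, add_zero, ite_self]
      by_cases hik : i = k
      · subst hik
        refine Finset.prod_eq_zero (Finset.mem_univ l) ?_
        simpa [Ne.symm hkl] using h.mixedMoment_zero_one
      · refine Finset.prod_eq_zero (Finset.mem_univ k) ?_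
        simpa [Ne.symm hik, hkl] using h.mixedMoment_one_zero
  · simp only [hij, if_false, zero_add, add_zero]
    by_cases hil : i = l
    · subst hil
      by_cases hjk : j = k
      · subst hjk
        simp only [if_true]
        refine Finset.prod_eq_one fun p _ => ?_
        by_cases h1 : p = i
        · subst h1
          simpa [hij] using h.mixedMoment_one_one
        · by_cases h2 : p = j
          · simpa [h1, h2, Ne.symm hij] using h.mixedMoment_one_one
          · simpa [h1, h2] using mixedMoment_zero_zero
      · simp only [hjk, if_true, if_false]
        refine Finset.prod_eq_zero (Finset.mem_univ j) ?_
        simpa [hjk, Ne.symm hij] using h.mixedMoment_zero_one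
    · simp only [hil, if_false]
      refine Finset.prod_eq_zero (Finset.mem_univ i) ?_
      by_cases hik : i = k
      · simpa [hij, hil, ← hik] using h.mixedMoment_two_zero
      · simpa [hij, hil, hik] using h.mixedMoment_one_zero

theorem integral_quadForm (h : IsEntryLaw ρ c) {R : Finset κ} (C : Matrix R R ℂ) :
    ∫ v : κ → ℂ, ∑ i : R, ∑ j : R, star (v i) * C i j * v j ∂(Measure.pi fun _ => ρ) =
      C.trace := by
  have e : ∀ v : κ → ℂ, ∑ i : R, ∑ j : R, star (v i) * C i j * v j =
      ∑ i : R, ∑ j : R, C i j * (star (v i) * v j) := fun v =>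
    Finset.sum_congr rfl fun i _ => Finset.sum_congr rfl fun j _ => by ring
  simp only [e]
  have i1 : ∀ i j : R, Integrable (fun v : κ → ℂ => C i j * (star (v i) * v j))
      (Measure.pi fun _ => ρ) := fun i j => (h.integrable_pair _ _).const_mul _
  have i2 : ∀ i : R, Integrable (fun v : κ → ℂ => ∑ j : R, C i j * (star (v i) * v j))
      (Measure.pi fun _ => ρ) := fun i => integrable_finsetSum _ fun j _ => i1 i j
  rw [integral_finsetSum _ fun i _ => i2 i]
  simp only [integral_finsetSum _ fun j _ => i1 _ j, integral_const_mul, h.integral_pair,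
    Subtype.coe_inj]
  simp [Matrix.trace]

theorem integral_quadForm_sq (h : IsEntryLaw ρ c) {R : Finset κ} (C : Matrix R R ℂ) :
    ∫ v : κ → ℂ, (∑ i : R, ∑ j : R, star (v i) * C i j * v j) ^ 2 ∂(Measure.pi fun _ => ρ) =
      C.trace ^ 2 + (C * C).trace + c * ∑ i : R, C i i ^ 2 := by
  have e : ∀ v : κ → ℂ, (∑ i : R, ∑ j : R, star (v i) * C i j * v j) ^ 2 =
      ∑ i : R, ∑ j : R, ∑ k : R, ∑ l : R,
        C i j * C k l * (star (v i) * v j * (star (v k) * v l)) := by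
    intro v
    rw [sq, Finset.sum_mul]
    refine Finset.sum_congr rfl fun i _ => ?_
    rw [Finset.sum_mul]
    refine Finset.sum_congr rfl fun j _ => ?_
    rw [Finset.mul_sum]
    refine Finset.sum_congr rfl fun k _ => ?_
    rw [Finset.mul_sum]
    refine Finset.sum_congr rfl fun l _ => ?_
    ring
  simp only [e]
  have i1 : ∀ i j k l : R, Integrable (fun v : κ → ℂ =>
      C i j * C k l * (star (v i) * v j * (star (v k) * v l))) (Measure.pi fun _ => ρ) :=
    fun i j k l => (h.integrable_quad _ _ _ _).const_mul _
  have i2 : ∀ i j k : R, Integrable (fun v : κ → ℂ => ∑ l : R,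
      C i j * C k l * (star (v i) * v j * (star (v k) * v l))) (Measure.pi fun _ => ρ) :=
    fun i j k => integrable_finsetSum _ fun l _ => i1 i j k l
  have i3 : ∀ i j : R, Integrable (fun v : κ → ℂ => ∑ k : R, ∑ l : R,
      C i j * C k l * (star (v i) * v j * (star (v k) * v l))) (Measure.pi fun _ => ρ) :=
    fun i j => integrable_finsetSum _ fun k _ => i2 i j k
  have i4 : ∀ i : R, Integrable (fun v : κ → ℂ => ∑ j : R, ∑ k : R, ∑ l : R,
      C i j * C k l * (star (v i) * v j * (star (v k) * v l))) (Measure.pi fun _ => ρ) :=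
    fun i => integrable_finsetSum _ fun j _ => i3 i j
  rw [integral_finsetSum _ fun i _ => i4 i]
  simp only [integral_finsetSum _ fun j _ => i3 _ j, integral_finsetSum _ fun k _ => i2 _ _ k,
    integral_finsetSum _ fun l _ => i1 _ _ _ l, integral_const_mul, h.integral_quad,
    Subtype.coe_inj, mul_add, Finset.sum_add_distrib]
  congr 1
  · congr 1
    · simp [Matrix.trace, sq, Finset.sum_mul_sum]
    · simp [Matrix.trace, mul_apply]
  · rw [Finset.mul_sum]
    simp [sq, mul_comm]

end IsEntryLaw

/-! ### Integrating out one column. -/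

section Resampling

variable {ι E : Type*} [Fintype ι] [DecidableEq ι] [MeasurableSpace E]

/-- Replacing one coordinate of a product measure by an independent copy preserves the measure. -/
theorem measurePreserving_update_prod (ν : Measure E) [IsProbabilityMeasure ν] (s : ι) :
    MeasurePreserving (fun p : (ι → E) × E => Function.update p.1 s p.2)
      ((Measure.pi fun _ => ν).prod ν) (Measure.pi fun _ => ν) := by
  have hm : Measurable fun p : (ι → E) × E => Function.update p.1 s p.2 := by
    refine measurable_pi_lambda _ fun t => ?_
    by_cases h : t = s
    · subst h
      simpa using measurable_snd
    · simp only [Function.update_of_ne h]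
      exact (measurable_pi_apply t).comp measurable_fst
  refine ⟨hm, (Measure.pi_eq fun A hA => ?_).symm⟩
  rw [Measure.map_apply hm (MeasurableSet.univ_pi hA)]
  have hpre : (fun p : (ι → E) × E => Function.update p.1 s p.2) ⁻¹' Set.pi Set.univ A =
      (Set.pi Set.univ (Function.update A s Set.univ)) ×ˢ A s := by
    ext ⟨x, v⟩
    simp only [Set.mem_preimage, Set.mem_pi, Set.mem_univ, true_implies, Set.mem_prod]
    constructor
    · intro h
      refine ⟨fun t => ?_, by simpa using h s⟩
      by_cases hts : t = s
      · subst hts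
        simp
      · simpa [hts] using h t
    · rintro ⟨h, hs⟩ t
      by_cases hts : t = s
      · subst hts
        simpa using hs
      · simpa [hts] using h t
  rw [hpre, Measure.prod_prod, Measure.pi_pi, ← Finset.mul_prod_erase _ _ (Finset.mem_univ s),
    ← Finset.mul_prod_erase Finset.univ (fun t => ν (A t)) (Finset.mem_univ s)]
  rw [Function.update_self, measure_univ, one_mul, mul_comm]
  congr 1
  refine Finset.prod_congr rfl fun t ht => ?_
  rw [Function.update_of_ne (Finset.ne_of_mem_erase ht)]

theorem integral_pi_eq_integral_update (ν : Measure E) [IsProbabilityMeasure ν] (s : ι)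
    {F : (ι → E) → ℂ} (hF : Integrable F (Measure.pi fun _ => ν)) :
    ∫ x, F x ∂(Measure.pi fun _ => ν) =
      ∫ x, ∫ v, F (Function.update x s v) ∂ν ∂(Measure.pi fun _ => ν) := by
  have h := measurePreserving_update_prod ν s
  rw [← h.map_eq, integral_map h.measurable.aemeasurable (by rw [h.map_eq]; exact hF.1), h.map_eq]
  exact integral_prod _ ((h.integrable_comp hF.1).2 hF)

end Resampling

/-! ### Integrability of Gram minors and the recursion for shared columns. -/

namespace IsEntryLaw

variable {ρ : Measure ℂ} [IsProbabilityMeasure ρ] {c : ℂ}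
variable {ι κ : Type*} [Fintype ι] [DecidableEq ι] [Fintype κ] [DecidableEq κ]

omit [DecidableEq κ] in
theorem integrable_one_add_norm_pow (h : IsEntryLaw ρ c) :
    Integrable (fun v : κ → ℂ => (1 + ‖v‖) ^ 4) (Measure.pi fun _ => ρ) := by
  have h1 : ∀ i : κ, Integrable (fun v : κ → ℂ => ‖v i‖ ^ 4) (Measure.pi fun _ => ρ) := fun i =>
    ((measurePreserving_eval (fun _ : κ => ρ) i).integrable_comp
      h.integrable_norm_pow.1).2 h.integrable_norm_pow
  refine Integrable.mono' (((integrable_const (1 : ℝ)).add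
    (integrable_finsetSum Finset.univ fun i _ => h1 i)).const_mul 16) (by fun_prop)
    (Eventually.of_forall fun v => ?_)
  have h2 : ‖v‖ ^ 4 ≤ ∑ i, ‖v i‖ ^ 4 := by
    rcases isEmpty_or_nonempty κ with hκ | hκ
    · simp [Subsingleton.elim v 0]
    · obtain ⟨i, hi⟩ := Finite.exists_max fun i => ‖v i‖
      have : ‖v‖ ≤ ‖v i‖ := (pi_norm_le_iff_of_nonneg (norm_nonneg _)).2 hi
      calc ‖v‖ ^ 4 ≤ ‖v i‖ ^ 4 := by gcongr
        _ ≤ _ := Finset.single_le_sum (f := fun i => ‖v i‖ ^ 4) (fun i _ => by positivity)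
            (Finset.mem_univ i)
  rw [Real.norm_of_nonneg (by positivity)]
  simp only [Pi.add_apply]
  have h3 : (1 + ‖v‖) ^ 4 ≤ 16 * (1 + ‖v‖ ^ 4) := by
    nlinarith [sq_nonneg (‖v‖ - 1), sq_nonneg (‖v‖ ^ 2 - 1), sq_nonneg (‖v‖ ^ 2 - ‖v‖),
      norm_nonneg v]
  linarith

omit [DecidableEq ι] [DecidableEq κ] in
theorem integrable_of_norm_le (h : IsEntryLaw ρ c) {F : (ι → κ → ℂ) → ℂ} (hF : Continuous F)
    (K : ℝ) (hK : ∀ x, ‖F x‖ ≤ K * ∏ s, (1 + ‖x s‖) ^ 4) :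
    Integrable F (Measure.pi fun _ => Measure.pi fun _ => ρ) := by
  refine Integrable.mono' (((Integrable.fintype_prod (f := fun (_ : ι) (v : κ → ℂ) =>
    (1 + ‖v‖) ^ 4) fun _ => h.integrable_one_add_norm_pow)).const_mul K)
    hF.aestronglyMeasurable (Eventually.of_forall hK)

omit [Fintype ι] [Fintype κ] [DecidableEq κ] in
theorem continuous_gramMinor (R : Finset κ) (S : Finset ι) :
    Continuous (gramMinor R S : (ι → κ → ℂ) → ℂ) := by
  unfold gramMinor gramDet columnMinor
  fun_prop

-- In the Leibniz expansion each column enters twice, once conjugated. A product of two minors is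
-- thus of degree at most four in every column, exactly what a finite fourth moment controls.
omit [DecidableEq κ] in
theorem exists_norm_gramMinor_le (R : Finset κ) (S : Finset ι) :
    ∃ K : ℝ, ∀ x : ι → κ → ℂ, ‖gramMinor R S x‖ ≤ K * ∏ s, (1 + ‖x s‖) ^ 2 := by
  refine ⟨(Fintype.card (Equiv.Perm S)) * (R.card : ℝ) ^ Fintype.card S, fun x => ?_⟩
  have hG : ∀ s t : S, ‖((columnMinor R S x)ᴴ * columnMinor R S x) s t‖ ≤
      R.card * (‖x s‖ * ‖x t‖) := by
    intro s t
    rw [mul_apply]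
    refine (norm_sum_le _ _).trans ?_
    have : ∀ i ∈ (Finset.univ : Finset R), ‖(columnMinor R S x)ᴴ s i * columnMinor R S x i t‖ ≤
        ‖x s‖ * ‖x t‖ := by
      intro i _
      rw [norm_mul, conjTranspose_apply, norm_star]
      exact mul_le_mul (norm_le_pi_norm (x s) i) (norm_le_pi_norm (x t) i) (norm_nonneg _)
        (norm_nonneg _)
    simpa using Finset.sum_le_card_nsmul _ _ _ this
  -- The summand 1 makes every factor at least 1, so columns outside S can be added to the product.
  have hP : ∏ t : S, ‖x t‖ ≤ ∏ s, (1 + ‖x s‖) := by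
    rw [Finset.prod_coe_sort S fun t => ‖x t‖, ← Finset.univ_inter S, ← Finset.prod_ite_mem]
    refine Finset.prod_le_prod (fun s _ => by split_ifs <;> positivity) fun s _ => ?_
    have := norm_nonneg (x s)
    split_ifs <;> linarith
  have hP0 : 0 ≤ ∏ t : S, ‖x t‖ := Finset.prod_nonneg fun _ _ => norm_nonneg _
  rw [gramMinor, gramDet, det_apply]
  refine (norm_sum_le _ _).trans ?_
  have : ∀ σ ∈ (Finset.univ : Finset (Equiv.Perm S)), ‖Equiv.Perm.sign σ •
      ∏ t, ((columnMinor R S x)ᴴ * columnMinor R S x) (σ t) t‖ ≤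
      (R.card : ℝ) ^ Fintype.card S * ∏ s, (1 + ‖x s‖) ^ 2 := by
    intro σ _
    have hs : ∀ z : ℂ, ‖Equiv.Perm.sign σ • z‖ = ‖z‖ := by
      intro z
      rcases Int.units_eq_one_or (Equiv.Perm.sign σ) with h | h <;> simp [h]
    rw [hs, norm_prod]
    calc _ ≤ ∏ t : S, ((R.card : ℝ) * (‖x (σ t)‖ * ‖x t‖)) :=
          Finset.prod_le_prod (fun _ _ => norm_nonneg _) fun t _ => hG _ _
      _ = (R.card : ℝ) ^ Fintype.card S * (∏ t : S, ‖x t‖) ^ 2 := by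
          rw [Finset.prod_mul_distrib, Finset.prod_mul_distrib,
            Equiv.prod_comp σ fun t : S => ‖x t‖, Finset.prod_const, Finset.card_univ]
          ring
      _ ≤ _ := by
          rw [Finset.prod_pow]
          gcongr
  refine (Finset.sum_le_card_nsmul _ _ _ this).trans ?_
  rw [Finset.card_univ, nsmul_eq_mul, mul_assoc]

omit [DecidableEq κ] in
theorem integrable_gramMinor_mul (h : IsEntryLaw ρ c) (R R' : Finset κ) (S S' : Finset ι) :
    Integrable (fun x : ι → κ → ℂ => gramMinor R S x * gramMinor R' S' x)
      (Measure.pi fun _ => Measure.pi fun _ => ρ) := by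
  obtain ⟨K, hK⟩ := exists_norm_gramMinor_le R S
  obtain ⟨K', hK'⟩ := exists_norm_gramMinor_le R' S'
  refine h.integrable_of_norm_le ((continuous_gramMinor R S).mul (continuous_gramMinor R' S'))
    (K * K') fun x => ?_
  rw [norm_mul]
  refine (mul_le_mul (hK x) (hK' x) (norm_nonneg _) ((norm_nonneg _).trans (hK x))).trans ?_
  simp only [Finset.prod_pow]
  exact le_of_eq (by ring)

/-- Removing a column that occurs in only one of two Gram determinants. -/
theorem integral_gramMinor_insert_mul (h : IsEntryLaw ρ c) (R R' : Finset κ) {S S' : Finset ι}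
    {s : ι} (hs : s ∉ S) (hs' : s ∉ S') :
    ∫ x, gramMinor R (insert s S) x * gramMinor R' S' x
        ∂(Measure.pi fun _ : ι => Measure.pi fun _ : κ => ρ) =
      ((R.card : ℂ) - S.card) * ∫ x, gramMinor R S x * gramMinor R' S' x
        ∂(Measure.pi fun _ : ι => Measure.pi fun _ : κ => ρ) := by
  rw [integral_pi_eq_integral_update _ s (h.integrable_gramMinor_mul _ _ _ _),
    ← integral_const_mul]
  congr 1
  ext x
  simp only [gramMinor_update hs', gramMinor_insert_update hs]
  rw [integral_mul_const, h.integral_quadForm, trace_gramForm]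
  simp only [Fintype.card_coe, gramMinor]
  ring

/-- With d = |R| − |S|, the terms (tr C)² and tr C² add up to (d² + d) G², and the diagonal term
removes a row. -/
theorem integral_gramMinor_insert_sq (h : IsEntryLaw ρ c) (R : Finset κ) {S : Finset ι}
    {s : ι} (hs : s ∉ S) :
    ∫ x, gramMinor R (insert s S) x ^ 2
        ∂(Measure.pi fun _ : ι => Measure.pi fun _ : κ => ρ) =
      ((R.card : ℂ) - S.card) * ((R.card : ℂ) - S.card + 1) * ∫ x, gramMinor R S x ^ 2
        ∂(Measure.pi fun _ : ι => Measure.pi fun _ : κ => ρ) +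
      c * ∑ i : R, ∫ x, gramMinor (R.erase i) S x ^ 2
        ∂(Measure.pi fun _ : ι => Measure.pi fun _ : κ => ρ) := by
  have hint : ∀ (R : Finset κ) (S : Finset ι), Integrable (fun x => gramMinor R S x ^ 2)
      (Measure.pi fun _ : ι => Measure.pi fun _ : κ => ρ) := fun R S => by
    simpa only [pow_two] using h.integrable_gramMinor_mul R R S S
  rw [integral_pi_eq_integral_update _ s (hint _ _), ← integral_finsetSum _ fun i _ => hint _ _,
    ← integral_const_mul, ← integral_const_mul, ← integral_add ((hint _ _).const_mul _)
      ((integrable_finsetSum _ fun i _ => hint _ _).const_mul _)]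
  congr 1
  ext x
  simp only [gramMinor_insert_update hs]
  rw [h.integral_quadForm_sq, trace_gramForm, trace_gramForm_mul_self]
  simp only [Fintype.card_coe, gramForm_columnMinor_diag, gramMinor]
  ring

end IsEntryLaw

/-! ### Mixed moments of Gram minors and their closed form. -/

/-- The second moment of a Gram determinant of `k` random vectors in dimension `r` whose
coordinates have fourth cumulant `c`. -/
noncomputable def gramMoment (c : ℂ) : ℕ → ℕ → ℂ
  | 0, _ => 1
  | k + 1, r => ((r : ℂ) - k) * ((r : ℂ) - k + 1) * gramMoment c k r +
      -- At r = 0 the subtraction truncates, but the factor r vanishes.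
      c * (r * gramMoment c k (r - 1))

namespace IsEntryLaw

variable {ρ : Measure ℂ} [IsProbabilityMeasure ρ] {c : ℂ}
variable {ι κ : Type*} [Fintype ι] [DecidableEq ι] [Fintype κ] [DecidableEq κ]

theorem integral_gramMinor_sq (h : IsEntryLaw ρ c) (R : Finset κ) (S : Finset ι) :
    ∫ x, gramMinor R S x ^ 2 ∂(Measure.pi fun _ : ι => Measure.pi fun _ : κ => ρ) =
      gramMoment c S.card R.card := by
  -- The row set must vary because the cumulant term erases a row.
  induction S using Finset.induction_on generalizing R with
  | empty => simp [gramMinor_empty, gramMoment]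
  | insert s S hs ih =>
    rw [h.integral_gramMinor_insert_sq R hs, Finset.card_insert_of_notMem hs, gramMoment]
    simp only [ih]
    congr 2
    rw [Finset.sum_congr rfl fun (i : R) _ => by rw [Finset.card_erase_of_mem i.2]]
    simp

/-- Columns of D leave one at a time, each contributing the codimension of those that remain; these
codimensions multiply to a falling factorial. `hcard` keeps the natural subtraction exact. -/
theorem integral_gramMinor_union_mul (h : IsEntryLaw ρ c) (R R' : Finset κ) {U D S' : Finset ι}
    (hD : Disjoint D U) (hD' : Disjoint D S') (hcard : U.card + D.card ≤ R.card) :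
    ∫ x, gramMinor R (D ∪ U) x * gramMinor R' S' x
        ∂(Measure.pi fun _ : ι => Measure.pi fun _ : κ => ρ) =
      ((R.card - U.card).descFactorial D.card : ℂ) * ∫ x, gramMinor R U x * gramMinor R' S' x
        ∂(Measure.pi fun _ : ι => Measure.pi fun _ : κ => ρ) := by
  induction D using Finset.induction_on with
  | empty => simp
  | insert s D hs ih =>
    rw [Finset.disjoint_insert_left] at hD hD'
    rw [Finset.card_insert_of_notMem hs] at hcard ⊢
    rw [Finset.insert_union, h.integral_gramMinor_insert_mul R R' (by simp [hs, hD.1]) hD'.1,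
      ih hD.2 hD'.2 (by omega), Finset.card_union_of_disjoint hD.2, Nat.descFactorial_succ,
      ← mul_assoc]
    congr 1
    rw [Nat.cast_mul, Nat.cast_sub (by omega), Nat.cast_sub (by omega)]
    push_cast
    ring

theorem integral_gramMinor_mul (h : IsEntryLaw ρ c) (S S' : Finset ι)
    (hcard : Fintype.card ι ≤ Fintype.card κ) :
    ∫ x, gramMinor Finset.univ S x * gramMinor Finset.univ S' x
        ∂(Measure.pi fun _ : ι => Measure.pi fun _ : κ => ρ) =
      ((Fintype.card κ - (S ∩ S').card).descFactorial (S \ S').card : ℂ) *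
      ((Fintype.card κ - (S ∩ S').card).descFactorial (S' \ S).card : ℂ) *
        gramMoment c (S ∩ S').card (Fintype.card κ) := by
  have h1 : S = (S \ S') ∪ (S ∩ S') := (Finset.sdiff_union_inter S S').symm
  have h2 : S' = (S' \ S) ∪ (S ∩ S') := by
    rw [Finset.inter_comm]; exact (Finset.sdiff_union_inter S' S).symm
  have hle : ∀ T : Finset ι, T.card ≤ Fintype.card κ := fun T => (Finset.card_le_univ T).trans hcard
  have e1 := h.integral_gramMinor_union_mul (κ := κ) Finset.univ Finset.univ (U := S ∩ S')
    (D := S \ S')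
    (S' := S') (Finset.disjoint_sdiff_inter S S') Finset.sdiff_disjoint (by
      rw [add_comm, Finset.card_sdiff_add_card_inter, Finset.card_univ]; exact hle S)
  have e2 := h.integral_gramMinor_union_mul (κ := κ) Finset.univ Finset.univ (U := S ∩ S')
    (D := S' \ S)
    (S' := S ∩ S') (by rw [Finset.inter_comm]; exact Finset.disjoint_sdiff_inter S' S)
    (by rw [Finset.inter_comm]; exact Finset.disjoint_sdiff_inter S' S) (by
      rw [add_comm, Finset.inter_comm, Finset.card_sdiff_add_card_inter, Finset.card_univ]
      exact hle S')
  rw [← h1, Finset.card_univ] at e1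
  rw [← h2, Finset.card_univ] at e2
  rw [e1]
  -- Exchanging the factors lets the same lemma strip S' \ S; what remains is a square.
  simp only [mul_comm (gramMinor (Finset.univ : Finset κ) (S ∩ S') _)]
  rw [e2]
  simp only [← sq]
  rw [h.integral_gramMinor_sq, Finset.card_univ]
  ring

end IsEntryLaw

-- The weight (r−k)! (r−k+1)! absorbs the factors of the recursion. After division by r! it reads
-- B(k+1, r) = B(k, r) + c B(k, r−1), which Pascal's rule solves.
open Nat in
theorem gramMoment_mul_factorial (c : ℂ) {k r : ℕ} (hk : k ≤ r) :
    gramMoment c k r * ((r - k)! * (r - k + 1)!) =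
      r ! * ∑ q ∈ Finset.range (k + 1), c ^ q * k.choose q * (r + 1 - q)! := by
  induction k generalizing r with
  | zero => simp [gramMoment]
  | succ k ih =>
    obtain ⟨l, rfl⟩ := Nat.exists_eq_add_of_le hk
    have ih1 := ih (r := k + 1 + l) (by omega)
    have ih2 := ih (r := k + l) (by omega)
    rw [show k + 1 + l - k = l + 1 by omega] at ih1
    rw [show k + l - k = l by omega] at ih2
    rw [gramMoment, show k + 1 + l - (k + 1) = l by omega, show k + 1 + l - 1 = k + l by omega]
    have hsum : ∑ q ∈ Finset.range (k + 1 + 1), c ^ q * (k + 1).choose q * (k + 1 + l + 1 - q)! =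
        ∑ q ∈ Finset.range (k + 1), c ^ q * k.choose q * (k + 1 + l + 1 - q)! +
          c * ∑ q ∈ Finset.range (k + 1), c ^ q * k.choose q * (k + l + 1 - q)! := by
      rw [Finset.sum_range_succ' _ (k + 1), Finset.mul_sum]
      simp only [Nat.choose_succ_succ, Nat.cast_add, mul_add, add_mul, Finset.sum_add_distrib]
      rw [Finset.sum_range_succ' (fun q => c ^ q * k.choose q * (k + 1 + l + 1 - q)! : ℕ → ℂ) k,
        Finset.sum_range_succ (fun q => c ^ (q + 1) * k.choose (q + 1) *
          (k + 1 + l + 1 - (q + 1))! : ℕ → ℂ) k]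
      have h0 : ∀ q ∈ Finset.range (k + 1), c ^ (q + 1) * k.choose q * (k + 1 + l + 1 - (q + 1))! =
          c * (c ^ q * k.choose q * (k + l + 1 - q)! : ℂ) := by
        intro q _
        rw [show k + 1 + l + 1 - (q + 1) = k + l + 1 - q by omega]
        ring
      rw [Finset.sum_congr rfl h0]
      simp
      ring
    rw [hsum, mul_add ((k + 1 + l)! : ℂ), ← ih1]
    have hf : ((k + 1 + l)! : ℂ) = (k + 1 + l) * (k + l)! := by
      rw [show k + 1 + l = (k + l) + 1 by omega, Nat.factorial_succ]
      push_cast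
      ring
    have h3 : ((k + 1 + l)! : ℂ) * (c * ∑ q ∈ Finset.range (k + 1), c ^ q * k.choose q *
        (k + l + 1 - q)!) = c * (k + 1 + l) * (gramMoment c k (k + l) * (l ! * (l + 1)!)) := by
      rw [ih2, hf]
      ring
    rw [h3]
    have h4 : ((l + 1)! : ℂ) = (l + 1) * l ! := by rw [Nat.factorial_succ]; push_cast; ring
    have h5 : ((l + 1 + 1)! : ℂ) = (l + 2) * (l + 1)! := by
      rw [Nat.factorial_succ (l + 1)]; push_cast; ring
    rw [h5, h4]
    push_cast
    ring

theorem sum_pairs_finset {ι : Type*} [Fintype ι] [DecidableEq ι] (g : ℕ → ℕ → ℕ → ℂ) :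
    ∑ S : Finset ι, ∑ S' : Finset ι, g (S \ S').card (S' \ S).card (S ∩ S').card =
      ∑ s ∈ Finset.range (Fintype.card ι + 1), ∑ u ∈ Finset.range (s + 1),
        ∑ b ∈ Finset.range (Fintype.card ι - s + 1),
          ((Fintype.card ι).choose s * s.choose u * (Fintype.card ι - s).choose b : ℂ) *
            g (s - u) b u := by
  have h1 : ∀ S : Finset ι, ∑ S' : Finset ι, g (S \ S').card (S' \ S).card (S ∩ S').card =
      ∑ u ∈ Finset.range (S.card + 1), ∑ b ∈ Finset.range (Fintype.card ι - S.card + 1),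
        (S.card.choose u * (Fintype.card ι - S.card).choose b : ℂ) * g (S.card - u) b u := by
    intro S
    have h2 : ∑ S' : Finset ι, g (S \ S').card (S' \ S).card (S ∩ S').card =
        ∑ U ∈ S.powerset, ∑ B ∈ Sᶜ.powerset, g (S.card - U.card) B.card U.card := by
      rw [← Finset.sum_product']
      refine Finset.sum_nbij' (fun S' => (S ∩ S', S' \ S)) (fun p => p.1 ∪ p.2) ?_ ?_ ?_ ?_ ?_
      · intro S' _
        simp only [Finset.mem_product, Finset.mem_powerset]
        refine ⟨Finset.inter_subset_left, fun i hi => ?_⟩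
        simp only [Finset.mem_sdiff] at hi
        simpa using hi.2
      · simp
      · intro S' _
        ext i
        simp only [Finset.mem_union, Finset.mem_inter, Finset.mem_sdiff]
        tauto
      · rintro ⟨U, B⟩ h
        simp only [Finset.mem_product, Finset.mem_powerset] at h
        have hU : ∀ i, i ∈ U → i ∈ S := fun i hi => h.1 hi
        have hB : ∀ i, i ∈ B → i ∉ S := fun i hi => by simpa using h.2 hi
        ext i <;> simp only [Finset.mem_union, Finset.mem_inter, Finset.mem_sdiff] <;>
          have := hU i <;> have := hB i <;> tauto
      · intro S' _
        have := Finset.card_sdiff_add_card_inter S S'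
        dsimp only
        rw [← this, Nat.add_sub_cancel]
    rw [h2]
    have h3 : ∀ U ∈ S.powerset, ∑ B ∈ Sᶜ.powerset, g (S.card - U.card) B.card U.card =
        ∑ b ∈ Finset.range (Fintype.card ι - S.card + 1),
          (Fintype.card ι - S.card).choose b • g (S.card - U.card) b U.card := by
      intro U _
      rw [Finset.sum_powerset_apply_card (fun b => g (S.card - U.card) b U.card),
        Finset.card_compl]
    rw [Finset.sum_congr rfl h3, Finset.sum_powerset_apply_card (fun u =>
      ∑ b ∈ Finset.range (Fintype.card ι - S.card + 1),
          (Fintype.card ι - S.card).choose b • g (S.card - u) b u)]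
    refine Finset.sum_congr rfl fun u _ => ?_
    rw [Finset.smul_sum]
    refine Finset.sum_congr rfl fun b _ => ?_
    simp only [nsmul_eq_mul]
    ring
  simp only [h1]
  rw [← Finset.powerset_univ, Finset.sum_powerset_apply_card (fun s =>
      ∑ u ∈ Finset.range (s + 1), ∑ b ∈ Finset.range (Fintype.card ι - s + 1),
        (s.choose u * (Fintype.card ι - s).choose b : ℂ) * g (s - u) b u), Finset.card_univ]
  refine Finset.sum_congr rfl fun s _ => ?_
  rw [Finset.smul_sum]
  refine Finset.sum_congr rfl fun u _ => ?_
  rw [Finset.smul_sum]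
  refine Finset.sum_congr rfl fun b _ => ?_
  simp only [nsmul_eq_mul]
  ring

open Nat in
/-- The summands of the expansion of `f(n, n - α; z, w) / (n! (n - α)!)`. -/
noncomputable def correlationTerm (α n : ℕ) (c z w : ℂ) (p : ℕ × ℕ × ℕ × ℕ) : ℂ :=
  c ^ p.1 * (-z) ^ (p.2.2.1 + p.2.2.2) * (-w) ^ (p.2.1 + p.2.2.2) /
    ((p.1)! * (p.2.1)! * (p.2.2.1)! * (p.2.2.2)! * (α + p.2.2.1 + p.2.2.2)! *
      (α + p.2.1 + p.2.2.2)! * (α + p.2.1 + p.2.2.1 + p.2.2.2 + 1 : ℕ)) *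
    (n + 1 - p.1).descFactorial (α + p.2.1 + p.2.2.1 + p.2.2.2 + 1)

-- Here |S ∩ S'| = q + t, |S \ S'| = a, |S' \ S| = b, and e columns lie in neither set. The slack t
-- replaces every subtraction by an addition and is then determined by the total number of columns.
open Nat in
theorem correlationTerm_eq (α : ℕ) (c z w : ℂ) (q t a b e : ℕ) :
    ((q + t + a + b + e).choose (q + t + a) * (q + t + a).choose (q + t) *
      (b + e).choose b : ℂ) * ((-z) ^ (b + e) * (-w) ^ (a + e) *
      ((α + a + b + e).descFactorial a * (α + a + b + e).descFactorial b) *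
      (((q + t + a + b + e + α)! * (c ^ q * (q + t).choose q * (q + t + a + b + e + α + 1 - q)!)) /
        ((α + a + b + e)! * (α + a + b + e + 1)!))) /
      ((q + t + a + b + e + α)! * (q + t + a + b + e)!) =
    correlationTerm α (q + t + a + b + e + α) c z w (q, a, b, e) := by
  have f0 : ∀ k : ℕ, (k ! : ℂ) ≠ 0 := fun k => by exact_mod_cast k.factorial_ne_zero
  have d1 : ((α + a + b + e).descFactorial a : ℂ) = (α + a + b + e)! / (α + b + e)! := by
    have := Nat.factorial_mul_descFactorial (n := α + a + b + e) (k := a) (by omega)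
    rw [show α + a + b + e - a = α + b + e by omega] at this
    rw [eq_div_iff (f0 _), mul_comm]
    exact_mod_cast this
  have d2 : ((α + a + b + e).descFactorial b : ℂ) = (α + a + b + e)! / (α + a + e)! := by
    have := Nat.factorial_mul_descFactorial (n := α + a + b + e) (k := b) (by omega)
    rw [show α + a + b + e - b = α + a + e by omega] at this
    rw [eq_div_iff (f0 _), mul_comm]
    exact_mod_cast this
  have d3 : ((q + t + a + b + e + α + 1 - q).descFactorial (α + a + b + e + 1) : ℂ) =
      (q + t + a + b + e + α + 1 - q)! / t ! := by
    have := Nat.factorial_mul_descFactorial (n := q + t + a + b + e + α + 1 - q)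
      (k := α + a + b + e + 1) (by omega)
    rw [show q + t + a + b + e + α + 1 - q - (α + a + b + e + 1) = t by omega] at this
    rw [eq_div_iff (f0 _), mul_comm]
    exact_mod_cast this
  have c1 : ((q + t + a + b + e).choose (q + t + a) : ℂ) =
      (q + t + a + b + e)! / ((q + t + a)! * (b + e)!) := by
    rw [add_assoc (q + t + a), Nat.cast_add_choose ℂ]
  have h1 : ((α + a + b + e + 1)! : ℂ) = (α + a + b + e + 1 : ℕ) * (α + a + b + e)! := by
    rw [Nat.factorial_succ]; push_cast; ring
  have h2 : ((α + a + b + e + 1 : ℕ) : ℂ) ≠ 0 := Nat.cast_ne_zero.2 (Nat.succ_ne_zero _)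
  simp only [correlationTerm]
  rw [d1, d2, d3, c1, Nat.cast_add_choose ℂ, Nat.cast_add_choose ℂ, Nat.cast_add_choose ℂ, h1]
  have := f0 (q + t + a + b + e)
  have := f0 (q + t + a + b + e + α)
  have := f0 (q + t + a)
  have := f0 (b + e)
  have := f0 (q + t)
  have := f0 q
  have := f0 t
  have := f0 a
  have := f0 b
  have := f0 e
  have := f0 (α + a + b + e)
  have := f0 (α + b + e)
  have := f0 (α + a + e)
  generalize ((q + t + a + b + e + α + 1 - q)! : ℂ) = A
  generalize ((α + a + b + e + 1 : ℕ) : ℂ) = B at *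
  field_simp

open Nat in
/-- The sum over pairs of column sets, as a series. -/
theorem sum_range_eq_tsum (α m : ℕ) (c z w : ℂ) :
    (∑ s ∈ Finset.range (m + 1), ∑ u ∈ Finset.range (s + 1), ∑ b ∈ Finset.range (m - s + 1),
      (m.choose s * s.choose u * (m - s).choose b : ℂ) *
        ((-z) ^ (m - (s - u + u)) * (-w) ^ (m - (b + u)) *
          ((m + α - u).descFactorial (s - u) * (m + α - u).descFactorial b *
            gramMoment c u (m + α)))) / ((m + α)! * m !) =
      ∑' p, correlationTerm α (m + α) c z w p := by
  have f0 : ∀ k : ℕ, (k ! : ℂ) ≠ 0 := fun k => by exact_mod_cast k.factorial_ne_zero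
  let F : Finset (ℕ × ℕ × ℕ × ℕ) := (Finset.range (m + 1) ×ˢ Finset.range (m + 1) ×ˢ
    Finset.range (m + 1) ×ˢ Finset.range (m + 1)).filter
      fun p => p.1 + p.2.1 + p.2.2.1 + p.2.2.2 ≤ m
  have hF : ∀ p : ℕ × ℕ × ℕ × ℕ, p ∈ F ↔ p.1 + p.2.1 + p.2.2.1 + p.2.2.2 ≤ m := by
    intro p
    simp only [F, Finset.mem_filter, Finset.mem_product, Finset.mem_range]
    omega
  -- Outside F the falling factorial in `correlationTerm` is zero, so the series is a finite sum.
  rw [tsum_eq_sum (s := F)]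
  swap
  · intro p hp
    rw [hF] at hp
    rw [correlationTerm, Nat.descFactorial_eq_zero_iff_lt.2 (by omega)]
    simp
  have hg : ∀ u ≤ m, gramMoment c u (m + α) = ∑ q ∈ Finset.range (u + 1),
      (m + α)! * (c ^ q * u.choose q * (m + α + 1 - q)!) /
        ((m + α - u)! * (m + α - u + 1)!) := by
    intro u hu
    rw [← Finset.sum_div, ← Finset.mul_sum, eq_div_iff (mul_ne_zero (f0 _) (f0 _))]
    exact gramMoment_mul_factorial c (by omega)
  have hterm : ∀ s ∈ Finset.range (m + 1), ∀ u ∈ Finset.range (s + 1),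
      ∀ b ∈ Finset.range (m - s + 1),
      (m.choose s * s.choose u * (m - s).choose b : ℂ) *
        ((-z) ^ (m - (s - u + u)) * (-w) ^ (m - (b + u)) *
          ((m + α - u).descFactorial (s - u) * (m + α - u).descFactorial b *
            gramMoment c u (m + α))) / ((m + α)! * m !) =
      ∑ q ∈ Finset.range (u + 1), correlationTerm α (m + α) c z w (q, s - u, b, m - s - b) := by
    intro s hs u hu b hb
    rw [Finset.mem_range] at hs hu hb
    rw [hg u (by omega), Finset.mul_sum, Finset.mul_sum, Finset.mul_sum, Finset.sum_div]
    refine Finset.sum_congr rfl fun q hq => ?_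
    rw [Finset.mem_range] at hq
    obtain ⟨t, rfl⟩ := Nat.exists_eq_add_of_le (show q ≤ u by omega)
    obtain ⟨a, rfl⟩ := Nat.exists_eq_add_of_le (show q + t ≤ s by omega)
    obtain ⟨e, rfl⟩ := Nat.exists_eq_add_of_le (show q + t + a + b ≤ m by omega)
    rw [show q + t + a + b + e - (q + t + a) - b = e by omega,
      show q + t + a + b + e - (q + t + a) = b + e by omega,
      show q + t + a - (q + t) = a by omega,
      show q + t + a + b + e - (a + (q + t)) = b + e by omega,
      show q + t + a + b + e - (b + (q + t)) = a + e by omega,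
      show q + t + a + b + e + α - (q + t) = α + a + b + e by omega, ← correlationTerm_eq]
    ring
  simp only [Finset.sum_div]
  rw [Finset.sum_congr rfl fun s hs => Finset.sum_congr rfl fun u hu =>
    Finset.sum_congr rfl fun b hb => hterm s hs u hu b hb]
  simp only [Finset.sum_sigma']
  refine Finset.sum_nbij' (fun x => (x.2.2.2, x.1 - x.2.1, x.2.2.1, m - x.1 - x.2.2.1))
    (fun p => ⟨m - p.2.2.1 - p.2.2.2, m - p.2.1 - p.2.2.1 - p.2.2.2, p.2.2.1, p.1⟩) ?_ ?_ ?_ ?_ ?_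
  · rintro ⟨s, u, b, q⟩ h
    simp only [Finset.mem_sigma, Finset.mem_range] at h
    rw [hF]
    dsimp only
    omega
  · rintro ⟨q, a, b, e⟩ h
    rw [hF] at h
    simp only [Finset.mem_sigma, Finset.mem_range]
    dsimp only at h
    omega
  · rintro ⟨s, u, b, q⟩ h
    simp only [Finset.mem_sigma, Finset.mem_range] at h
    dsimp only
    rw [show m - b - (m - s - b) = s by omega, show m - (s - u) - b - (m - s - b) = u by omega]
  · rintro ⟨q, a, b, e⟩ h
    rw [hF] at h
    dsimp only at h ⊢
    rw [show m - b - e - (m - a - b - e) = a by omega, show m - (m - b - e) - b = e by omega]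
  · rintro ⟨s, u, b, q⟩ h
    rfl

/-! ### The law of one complex entry. -/

section ProductLaw

/-- A product measure over pairs is an iterated product measure. -/
theorem map_pi_prod_eq_pi_pi {ι κ E : Type*} [Fintype ι] [Fintype κ] [MeasurableSpace E]
    (ν : Measure E) [IsProbabilityMeasure ν] :
    (Measure.pi fun _ : κ × ι => ν).map (fun x s i => x (i, s)) =
      Measure.pi fun _ : ι => Measure.pi fun _ : κ => ν := by
  have hm : Measurable fun (x : ι → κ → E) (p : κ × ι) => x p.2 p.1 := by fun_prop
  have h : (Measure.pi fun _ : κ × ι => ν) =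
      (Measure.pi fun _ : ι => Measure.pi fun _ : κ => ν).map fun x p => x p.2 p.1 := by
    refine Measure.pi_eq fun A hA => ?_
    rw [Measure.map_apply hm (MeasurableSet.univ_pi hA)]
    have : (fun (x : ι → κ → E) (p : κ × ι) => x p.2 p.1) ⁻¹' Set.pi Set.univ A =
        Set.pi Set.univ fun s => Set.pi Set.univ fun i => A (i, s) := by
      ext x
      simp only [Set.mem_preimage, Set.mem_pi, Set.mem_univ, true_implies, Prod.forall]
      exact forall_comm
    rw [this, Measure.pi_pi, Fintype.prod_prod_type_right]
    simp only [Measure.pi_pi]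
  rw [h, Measure.map_map (by fun_prop) hm]
  exact Measure.map_id

/-- The law on `ℂ` with independent real and imaginary parts of law `Q`. -/
noncomputable def complexLaw (Q : Measure ℝ) : Measure ℂ :=
  (Q.prod Q).map Complex.measurableEquivRealProd.symm

instance (Q : Measure ℝ) [IsProbabilityMeasure Q] : IsProbabilityMeasure (complexLaw Q) :=
  Measure.isProbabilityMeasure_map Complex.measurableEquivRealProd.symm.measurable.aemeasurable

theorem integrable_pow_of_memLp_four {Q : Measure ℝ} [IsProbabilityMeasure Q]
    (hQ : MemLp (fun x : ℝ => x) 4 Q) {i : ℕ} (hi : i ≤ 4) : Integrable (fun x => x ^ i) Q := by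
  have h4 : Integrable (fun x : ℝ => ‖x‖ ^ 4) Q :=
    MemLp.integrable_norm_pow (p := 4) (by exact_mod_cast hQ) (by norm_num)
  refine Integrable.mono' ((integrable_const (1 : ℝ)).add h4) (by fun_prop)
    (Eventually.of_forall fun x => ?_)
  rw [norm_pow]
  simp only [Pi.add_apply]
  rcases le_total ‖x‖ 1 with hx | hx
  · have := pow_le_one₀ (n := i) (norm_nonneg x) hx
    have : 0 ≤ ‖x‖ ^ 4 := by positivity
    linarith
  · have := pow_le_pow_right₀ hx hi
    linarith

theorem integral_add_add {Ω : Type*} [MeasurableSpace Ω] {μ : Measure Ω} {f g h : Ω → ℂ}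
    (hf : Integrable f μ) (hg : Integrable g μ) (hh : Integrable h μ) :
    ∫ x, f x + g x + h x ∂μ = ∫ x, f x ∂μ + ∫ x, g x ∂μ + ∫ x, h x ∂μ := by
  rw [← integral_add hf hg]
  exact integral_add (hf.add hg) hh

/-- Equal variances of independent centred parts cancel in E z². Also E|z|⁴ = 2b + 2 · (1/2)² = 2 +
2(b − 3/4), which fixes the cumulant. -/
theorem isEntryLaw_complexLaw {Q : Measure ℝ} [IsProbabilityMeasure Q]
    (hQ : MemLp (fun x : ℝ => x) 4 Q) (hmean : ∫ x, x ∂Q = 0) (hvar : ∫ x, x ^ 2 ∂Q = 1 / 2)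
    {b : ℝ} (hb : ∫ x, x ^ 4 ∂Q = b) :
    IsEntryLaw (complexLaw Q) ((2 * (b - 3 / 4) : ℝ) : ℂ) := by
  have hi : ∀ i j : ℕ, i ≤ 4 → j ≤ 4 →
      Integrable (fun p : ℝ × ℝ => p.1 ^ i * p.2 ^ j) (Q.prod Q) := fun i j hi hj =>
    (integrable_pow_of_memLp_four hQ hi).mul_prod (integrable_pow_of_memLp_four hQ hj)
  have hiC : ∀ i j : ℕ, i ≤ 4 → j ≤ 4 →
      Integrable (fun p : ℝ × ℝ => (p.1 : ℂ) ^ i * (p.2 : ℂ) ^ j) (Q.prod Q) := fun i j h h' => by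
    simpa using (hi i j h h').ofReal (𝕜 := ℂ)
  have hv : ∀ i j : ℕ, ∫ p : ℝ × ℝ, (p.1 : ℂ) ^ i * (p.2 : ℂ) ^ j ∂(Q.prod Q) =
      (((∫ x, x ^ i ∂Q) * ∫ x, x ^ j ∂Q : ℝ) : ℂ) := fun i j => by
    rw [← integral_prod_mul, ← integral_complex_ofReal]
    simp
  have hmap : ∀ F : ℂ → ℂ, ∫ z, F z ∂(complexLaw Q) =
      ∫ p : ℝ × ℝ, F ((p.1 : ℂ) + p.2 * Complex.I) ∂(Q.prod Q) := fun F => by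
    rw [complexLaw, integral_map_equiv]
    congr 1
    ext p
    congr 1
    apply Complex.ext <;> simp [Complex.measurableEquivRealProd]
  have h0 : ∫ x, x ^ 0 ∂Q = 1 := by simp
  have h1 : ∫ x, x ^ 1 ∂Q = 0 := by simpa using hmean
  refine ⟨?_, ?_, ?_, ?_, ?_⟩
  · rw [complexLaw, integrable_map_equiv]
    have e : ((fun z : ℂ => ‖z‖ ^ 4) ∘ Complex.measurableEquivRealProd.symm) =
        fun p : ℝ × ℝ => p.1 ^ 4 * p.2 ^ 0 + 2 * (p.1 ^ 2 * p.2 ^ 2) + p.1 ^ 0 * p.2 ^ 4 := by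
      ext p
      have : ‖Complex.measurableEquivRealProd.symm p‖ ^ 2 = p.1 ^ 2 + p.2 ^ 2 := by
        rw [Complex.sq_norm, Complex.normSq_apply]
        simp [Complex.measurableEquivRealProd]
        ring
      simp only [Function.comp]
      rw [show (4 : ℕ) = 2 * 2 by norm_num, pow_mul, this]
      ring
    rw [e]
    exact ((hi 4 0 (by norm_num) (by norm_num)).add ((hi 2 2 (by norm_num) (by norm_num)).const_mul
      2)).add (hi 0 4 (by norm_num) (by norm_num))
  · rw [hmap]
    have e : ∀ p : ℝ × ℝ, (p.1 : ℂ) + p.2 * Complex.I =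
        (p.1 : ℂ) ^ 1 * (p.2 : ℂ) ^ 0 + Complex.I * ((p.1 : ℂ) ^ 0 * (p.2 : ℂ) ^ 1) := fun p => by
      ring
    simp only [e]
    rw [integral_add (hiC 1 0 (by norm_num) (by norm_num))
      ((hiC 0 1 (by norm_num) (by norm_num)).const_mul _), integral_const_mul, hv, hv, h0, h1]
    simp
  · rw [hmap]
    have e : ∀ p : ℝ × ℝ, ((p.1 : ℂ) + p.2 * Complex.I) ^ 2 =
        (p.1 : ℂ) ^ 2 * (p.2 : ℂ) ^ 0 + (-1) * ((p.1 : ℂ) ^ 0 * (p.2 : ℂ) ^ 2) +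
          2 * Complex.I * ((p.1 : ℂ) ^ 1 * (p.2 : ℂ) ^ 1) := fun p => by
      linear_combination (p.2 : ℂ) ^ 2 * Complex.I_sq
    simp only [e]
    rw [integral_add_add (hiC 2 0 (by norm_num) (by norm_num))
      ((hiC 0 2 (by norm_num) (by norm_num)).const_mul _)
      ((hiC 1 1 (by norm_num) (by norm_num)).const_mul _), integral_const_mul, integral_const_mul,
      hv, hv, hv, h0, h1, hvar]
    simp
  · rw [hmap]
    have e : ∀ p : ℝ × ℝ, star ((p.1 : ℂ) + p.2 * Complex.I) * ((p.1 : ℂ) + p.2 * Complex.I) =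
        (p.1 : ℂ) ^ 2 * (p.2 : ℂ) ^ 0 + ((p.1 : ℂ) ^ 0 * (p.2 : ℂ) ^ 2) := fun p => by
      simp only [Complex.star_def, map_add, map_mul, Complex.conj_ofReal, Complex.conj_I]
      linear_combination -(p.2 : ℂ) ^ 2 * Complex.I_sq
    simp only [e]
    rw [integral_add (hiC 2 0 (by norm_num) (by norm_num)) (hiC 0 2 (by norm_num) (by norm_num)),
      hv, hv, h0, hvar]
    norm_num
  · rw [hmap]
    have e : ∀ p : ℝ × ℝ, star ((p.1 : ℂ) + p.2 * Complex.I) ^ 2 *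
        ((p.1 : ℂ) + p.2 * Complex.I) ^ 2 = (p.1 : ℂ) ^ 4 * (p.2 : ℂ) ^ 0 +
          2 * ((p.1 : ℂ) ^ 2 * (p.2 : ℂ) ^ 2) + (p.1 : ℂ) ^ 0 * (p.2 : ℂ) ^ 4 := fun p => by
      have : star ((p.1 : ℂ) + p.2 * Complex.I) * ((p.1 : ℂ) + p.2 * Complex.I) =
          (p.1 : ℂ) ^ 2 + (p.2 : ℂ) ^ 2 := by
        simp only [Complex.star_def, map_add, map_mul, Complex.conj_ofReal, Complex.conj_I]
        linear_combination -(p.2 : ℂ) ^ 2 * Complex.I_sq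
      rw [← mul_pow, this]
      ring
    simp only [e]
    rw [integral_add_add (hiC 4 0 (by norm_num) (by norm_num))
      ((hiC 2 2 (by norm_num) (by norm_num)).const_mul _)
      (hiC 0 4 (by norm_num) (by norm_num)), integral_const_mul,
      hv, hv, hv, h0, hvar, hb]
    push_cast
    ring

end ProductLaw

/-! ### The joint law of the columns. -/

namespace IsComplexSampleMatrix

variable {Ω : Type*} [MeasurableSpace Ω] {P : Measure Ω} [IsProbabilityMeasure P] {Q : Measure ℝ}
  [IsProbabilityMeasure Q] {n m : ℕ} {X : Ω → Matrix (Fin n) (Fin m) ℂ}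

omit [IsProbabilityMeasure Q] in
theorem map_entry (hX : IsComplexSampleMatrix P Q X) (i : Fin n) (j : Fin m) :
    P.map (fun ω => X ω i j) = complexLaw Q := by
  have hre : Measurable fun ω => (X ω i j).re := Complex.measurable_re.comp (hX.measurable i j)
  have him : Measurable fun ω => (X ω i j).im := Complex.measurable_im.comp (hX.measurable i j)
  have h := (indepFun_iff_map_prod_eq_prod_map_map hre.aemeasurable him.aemeasurable).1
    (hX.indep_re_im i j)
  rw [hX.law_re, hX.law_im] at h
  rw [complexLaw, ← h, Measure.map_map Complex.measurableEquivRealProd.symm.measurable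
    (hre.prodMk him)]
  congr 1

theorem map_columns (hX : IsComplexSampleMatrix P Q X) :
    P.map (fun ω s i => X ω i s) =
      Measure.pi fun _ : Fin m => Measure.pi fun _ : Fin n => complexLaw Q := by
  have hm : Measurable fun ω (p : Fin n × Fin m) => X ω p.1 p.2 :=
    measurable_pi_lambda _ fun p => hX.measurable p.1 p.2
  have h := (iIndepFun_iff_map_fun_eq_pi_map fun p : Fin n × Fin m =>
    (hX.measurable p.1 p.2).aemeasurable).1 hX.indep
  simp only [hX.map_entry] at h
  rw [← map_pi_prod_eq_pi_pi, ← h, Measure.map_map (by fun_prop) hm]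
  rfl

omit [IsProbabilityMeasure P] [IsProbabilityMeasure Q] in
theorem measurable_columns (hX : IsComplexSampleMatrix P Q X) :
    Measurable fun ω (s : Fin m) (i : Fin n) => X ω i s :=
  measurable_pi_lambda _ fun s => measurable_pi_lambda _ fun i => hX.measurable i s

end IsComplexSampleMatrix

/-! ### The correlation function as an explicit series. -/

section Correlation

variable {Ω : Type*} [MeasurableSpace Ω] {P : Measure Ω} [IsProbabilityMeasure P] {Q : Measure ℝ}
  [IsProbabilityMeasure Q] {n m : ℕ} {X : Ω → Matrix (Fin n) (Fin m) ℂ} {c : ℂ}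

omit [MeasurableSpace Ω] in
theorem charPolyProduct_eq_sum (X : Ω → Matrix (Fin n) (Fin m) ℂ) (z w : ℂ) (ω : Ω) :
    charPolyProduct X z w ω = ∑ S : Finset (Fin m), ∑ S' : Finset (Fin m),
      ((-z) ^ (m - S.card) * (-w) ^ (m - S'.card)) *
        (gramMinor Finset.univ S (fun s i => X ω i s) *
          gramMinor Finset.univ S' (fun s i => X ω i s)) := by
  have h := fun z => det_conjTranspose_mul_self_sub (fun s i => X ω i s) z
  have e : (Matrix.of fun i s => X ω i s) = X ω := rfl
  simp only [e, Fintype.card_fin] at h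
  rw [charPolyProduct, h, h, Finset.sum_mul_sum]
  refine Finset.sum_congr rfl fun S _ => Finset.sum_congr rfl fun S' _ => ?_
  ring

theorem integrable_gramMinor_mul_columns (hX : IsComplexSampleMatrix P Q X)
    (hQ : IsEntryLaw (complexLaw Q) c) (S S' : Finset (Fin m)) :
    Integrable (fun ω => gramMinor Finset.univ S (fun s i => X ω i s) *
          gramMinor Finset.univ S' (fun s i => X ω i s)) P := by
  have h := hQ.integrable_gramMinor_mul (Finset.univ : Finset (Fin n)) Finset.univ S S'
  rw [← hX.map_columns] at h
  exact h.comp_measurable hX.measurable_columns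

theorem integrable_charPolyProduct (hX : IsComplexSampleMatrix P Q X)
    (hQ : IsEntryLaw (complexLaw Q) c) (z w : ℂ) : Integrable (charPolyProduct X z w) P := by
  have : charPolyProduct X z w = fun ω => _ := funext (charPolyProduct_eq_sum X z w)
  rw [this]
  exact integrable_finsetSum _ fun S _ => integrable_finsetSum _ fun S' _ =>
    (integrable_gramMinor_mul_columns hX hQ S S').const_mul _

open Nat in
theorem secondOrderCorrelation_div_eq_tsum {α : ℕ} (hn : n = m + α)
    (hX : IsComplexSampleMatrix P Q X) (hQ : IsEntryLaw (complexLaw Q) c) (z w : ℂ) :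
    secondOrderCorrelation P X z w / ((n ! : ℂ) * (m ! : ℂ)) =
      ∑' p, correlationTerm α n c z w p := by
  have hint := fun S S' => integrable_gramMinor_mul_columns hX hQ S S'
  have hval : ∀ S S' : Finset (Fin m), ∫ ω, gramMinor Finset.univ S (fun s i => X ω i s) *
      gramMinor Finset.univ S' (fun s i => X ω i s) ∂P =
      ((n - (S ∩ S').card).descFactorial (S \ S').card : ℂ) *
      ((n - (S ∩ S').card).descFactorial (S' \ S).card : ℂ) *
        gramMoment c (S ∩ S').card n := by
    intro S S'
    have h := hQ.integral_gramMinor_mul (κ := Fin n) S S' (by simp [hn])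
    rw [← hX.map_columns, integral_map hX.measurable_columns.aemeasurable
      (by
        rw [hX.map_columns]
        exact (hQ.integrable_gramMinor_mul Finset.univ Finset.univ S S').1)] at h
    simpa only [Fintype.card_fin] using h
  have hsum : secondOrderCorrelation P X z w = ∑ S : Finset (Fin m), ∑ S' : Finset (Fin m),
      (-z) ^ (m - ((S \ S').card + (S ∩ S').card)) *
        (-w) ^ (m - ((S' \ S).card + (S ∩ S').card)) *
        (((n - (S ∩ S').card).descFactorial (S \ S').card : ℂ) *
          ((n - (S ∩ S').card).descFactorial (S' \ S).card : ℂ) *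
          gramMoment c (S ∩ S').card n) := by
    rw [secondOrderCorrelation]
    simp only [charPolyProduct_eq_sum]
    rw [integral_finsetSum _ fun S _ => integrable_finsetSum _ fun S' _ =>
      (hint S S').const_mul _]
    refine Finset.sum_congr rfl fun S _ => ?_
    rw [integral_finsetSum _ fun S' _ => (hint S S').const_mul _]
    refine Finset.sum_congr rfl fun S' _ => ?_
    rw [integral_const_mul, hval, Finset.card_sdiff_add_card_inter, Finset.inter_comm S S',
      Finset.card_sdiff_add_card_inter]
  rw [hsum, sum_pairs_finset fun a b u => (-z) ^ (m - (a + u)) * (-w) ^ (m - (b + u)) *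
        (((n - u).descFactorial a : ℂ) * ((n - u).descFactorial b : ℂ) * gramMoment c u n),
    Fintype.card_fin]
  subst hn
  exact sum_range_eq_tsum α m c z w

end Correlation

/-! ### Termwise limit and domination. -/

section Asymptotics

theorem tendsto_natCast_add_one_sub_div (j : ℕ) :
    Tendsto (fun N : ℕ => ((N + 1 - j : ℕ) : ℂ) / N) atTop (𝓝 1) := by
  have h1 : Tendsto (fun N : ℕ => (1 : ℂ) + (1 - (j : ℂ)) * (N : ℂ)⁻¹) atTop
      (𝓝 (1 + (1 - (j : ℂ)) * 0)) :=
    tendsto_const_nhds.add (tendsto_const_nhds.mul tendsto_inv_atTop_nhds_zero_nat)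
  rw [mul_zero, add_zero] at h1
  refine h1.congr' ?_
  filter_upwards [eventually_ge_atTop (j + 1)] with N hN
  have hN0 : (N : ℂ) ≠ 0 := Nat.cast_ne_zero.2 (by omega)
  rw [Nat.cast_sub (by omega)]
  push_cast
  field_simp
  ring

theorem tendsto_descFactorial_div_pow (q k : ℕ) :
    Tendsto (fun N : ℕ => ((N + 1 - q).descFactorial k : ℂ) / (N : ℂ) ^ k) atTop (𝓝 1) := by
  induction k with
  | zero => simp
  | succ k ih =>
    have h := (tendsto_natCast_add_one_sub_div (q + k)).mul ih
    rw [one_mul] at h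
    refine h.congr fun N => ?_
    rw [Nat.descFactorial_succ, Nat.sub_sub, Nat.cast_mul, pow_succ', mul_div_mul_comm]

theorem tendsto_descFactorial_div_pow_add (q k e : ℕ) :
    Tendsto (fun N : ℕ => ((N + 1 - q).descFactorial k : ℂ) / (N : ℂ) ^ (k + e)) atTop
      (𝓝 (if e = 0 then 1 else 0)) := by
  have h1 : Tendsto (fun N : ℕ => ((N : ℂ)⁻¹) ^ e) atTop (𝓝 (0 ^ e)) :=
    tendsto_inv_atTop_nhds_zero_nat.pow e
  have h := (tendsto_descFactorial_div_pow q k).mul h1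
  rw [one_mul, zero_pow_eq] at h
  refine h.congr fun N => ?_
  rw [inv_pow, pow_add, div_mul_eq_div_div, div_eq_mul_inv (_ / _)]

theorem norm_descFactorial_div_pow_le (q k e : ℕ) {N : ℕ} (hN : 1 ≤ N) :
    ‖((N + 1 - q).descFactorial k : ℂ) / (N : ℂ) ^ (k + e)‖ ≤ 2 ^ k := by
  have hN' : (1 : ℝ) ≤ N := by exact_mod_cast hN
  rw [norm_div, norm_pow, Complex.norm_natCast, Complex.norm_natCast,
    div_le_iff₀ (by positivity)]
  have h1 : ((N + 1 - q).descFactorial k : ℝ) ≤ (2 * N : ℝ) ^ k := by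
    have := (Nat.descFactorial_le_pow (N + 1 - q) k).trans
      (Nat.pow_le_pow_left (show N + 1 - q ≤ 2 * N by omega) k)
    exact_mod_cast this
  calc _ ≤ (2 * N : ℝ) ^ k := h1
    _ = 2 ^ k * (N : ℝ) ^ k := mul_pow _ _ _
    _ ≤ _ := by
        gcongr
        omega

open Nat in
/-- The part of `correlationTerm` that does not depend on `n`. -/
noncomputable def correlationCoeff (α : ℕ) (c x y : ℂ) (p : ℕ × ℕ × ℕ × ℕ) : ℂ :=
  c ^ p.1 * (-x) ^ (p.2.2.1 + p.2.2.2) * (-y) ^ (p.2.1 + p.2.2.2) /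
    ((p.1)! * (p.2.1)! * (p.2.2.1)! * (p.2.2.2)! * (α + p.2.2.1 + p.2.2.2)! *
      (α + p.2.1 + p.2.2.2)! * (α + p.2.1 + p.2.2.1 + p.2.2.2 + 1 : ℕ))

/-- Power counting: z and w contribute N^(−a−b−2e) and the normalisation N^(−α−1), against a falling
factorial of degree α+a+b+e+1. The surplus N^(−e) removes every term with e > 0 in the limit. -/
theorem correlationTerm_div_pow (α N : ℕ) (c x y : ℂ) (p : ℕ × ℕ × ℕ × ℕ) :
    correlationTerm α N c (x / N) (y / N) p / (N : ℂ) ^ (α + 1) = correlationCoeff α c x y p *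
      (((N + 1 - p.1).descFactorial (α + p.2.1 + p.2.2.1 + p.2.2.2 + 1) : ℂ) /
        (N : ℂ) ^ (α + p.2.1 + p.2.2.1 + p.2.2.2 + 1 + p.2.2.2)) := by
  rw [correlationTerm, correlationCoeff, ← neg_div, ← neg_div, div_pow, div_pow]
  rw [show α + p.2.1 + p.2.2.1 + p.2.2.2 + 1 + p.2.2.2 =
    (p.2.2.1 + p.2.2.2) + (p.2.1 + p.2.2.2) + (α + 1) by ring, pow_add, pow_add]
  simp only [div_eq_mul_inv, mul_inv]
  ring

open Nat in
/-- A summable bound for the rescaled terms of the expansion. -/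
noncomputable def correlationBound (α : ℕ) (c x y : ℂ) (p : ℕ × ℕ × ℕ × ℕ) : ℝ :=
  2 ^ (α + 1) * (‖c‖ ^ p.1 / (p.1)! * ((2 * ‖y‖) ^ p.2.1 / (p.2.1)! *
    ((2 * ‖x‖) ^ p.2.2.1 / (p.2.2.1)! * ((2 * (‖x‖ * ‖y‖)) ^ p.2.2.2 / (p.2.2.2)!))))

theorem summable_correlationBound (α : ℕ) (c x y : ℂ) : Summable (correlationBound α c x y) := by
  have h1 := Real.summable_pow_div_factorial ‖c‖
  have h2 := Real.summable_pow_div_factorial (2 * ‖y‖)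
  have h3 := Real.summable_pow_div_factorial (2 * ‖x‖)
  have h4 := Real.summable_pow_div_factorial (2 * (‖x‖ * ‖y‖))
  refine Summable.mul_left _ ?_
  exact h1.mul_of_nonneg (h2.mul_of_nonneg (h3.mul_of_nonneg h4
    (fun _ => by positivity) (fun _ => by positivity)) (fun _ => by positivity)
    (fun _ => by positivity)) (fun _ => by positivity) (fun _ => by positivity)

open Nat in
theorem norm_correlationCoeff_mul_le (α : ℕ) (c x y : ℂ) (p : ℕ × ℕ × ℕ × ℕ) :
    ‖correlationCoeff α c x y p‖ * 2 ^ (α + p.2.1 + p.2.2.1 + p.2.2.2 + 1) ≤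
      correlationBound α c x y p := by
  obtain ⟨q, a, b, e⟩ := p
  simp only [correlationCoeff, correlationBound, norm_div, norm_mul, norm_pow, norm_neg,
    Complex.norm_natCast]
  have f1 : ∀ k : ℕ, (1 : ℝ) ≤ (k ! : ℝ) := fun k => by exact_mod_cast k.factorial_pos
  have f0 : ∀ k : ℕ, (0 : ℝ) < (k ! : ℝ) := fun k => by exact_mod_cast k.factorial_pos
  have h1 : (1 : ℝ) ≤ (α + b + e)! * (α + a + e)! * (α + a + b + e + 1 : ℕ) := by
    exact_mod_cast Nat.succ_le_of_lt (Nat.mul_pos (Nat.mul_pos (Nat.factorial_pos _)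
      (Nat.factorial_pos _)) (Nat.succ_pos _))
  have h2 : ((q)! * (a)! * (b)! * (e)! : ℝ) ≤ (q)! * (a)! * (b)! * (e)! * (α + b + e)! *
      (α + a + e)! * (α + a + b + e + 1 : ℕ) := by
    have : (0 : ℝ) ≤ (q)! * (a)! * (b)! * (e)! := by positivity
    calc ((q)! * (a)! * (b)! * (e)! : ℝ) ≤ ((q)! * (a)! * (b)! * (e)!) *
          ((α + b + e)! * (α + a + e)! * (α + a + b + e + 1 : ℕ)) := le_mul_of_one_le_right this h1
      _ = _ := by ring
  have h3 : (0 : ℝ) < (q)! * (a)! * (b)! * (e)! := by positivity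
  calc _ ≤ ‖c‖ ^ q * ‖x‖ ^ (b + e) * ‖y‖ ^ (a + e) / ((q)! * (a)! * (b)! * (e)!) *
        2 ^ (α + a + b + e + 1) := by gcongr
    _ = _ := by
        simp only [mul_pow, pow_add, div_eq_mul_inv, mul_inv]
        ring

theorem tendsto_tsum_correlationTerm (α : ℕ) (c x y : ℂ) :
    Tendsto (fun N : ℕ => (∑' p, correlationTerm α N c (x / N) (y / N) p) / (N : ℂ) ^ (α + 1))
      atTop (𝓝 (∑' p : ℕ × ℕ × ℕ × ℕ,
        correlationCoeff α c x y p * if p.2.2.2 = 0 then 1 else 0)) := by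
  simp only [← tsum_div_const, correlationTerm_div_pow]
  refine tendsto_tsum_of_dominated_convergence (summable_correlationBound α c x y) ?_ ?_
  · intro p
    exact (tendsto_descFactorial_div_pow_add _ _ _).const_mul _
  · filter_upwards [eventually_ge_atTop 1] with N hN p
    rw [norm_mul]
    exact (mul_le_mul_of_nonneg_left (norm_descFactorial_div_pow_le _ _ _ hN)
      (norm_nonneg _)).trans (norm_correlationCoeff_mul_le α c x y p)

open Nat in
/-- The coefficients of the power series of the Bessel function. -/
noncomputable def besselCoeff (α k : ℕ) : ℝ := (-1) ^ k / (k ! * (k + α)!)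

/-- The double power series of the Bessel kernel. -/
noncomputable def besselKernelSeries (α : ℕ) (z w : ℝ) : ℝ :=
  ∑' p : ℕ × ℕ, besselCoeff α p.1 * z ^ p.1 * (besselCoeff α p.2 * w ^ p.2) /
    (α + p.1 + p.2 + 1)

theorem tsum_correlationCoeff (α : ℕ) (c x y : ℝ) :
    ∑' p : ℕ × ℕ × ℕ × ℕ, correlationCoeff α c x y p * (if p.2.2.2 = 0 then 1 else 0) =
      ((Real.exp c * besselKernelSeries α x y : ℝ) : ℂ) := by
  let L : ℕ × ℕ × ℕ → ℂ := fun r => correlationCoeff α 0 x y (0, r) * if r.2.2 = 0 then 1 else 0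
  let E : ℕ → ℂ := fun q => (c : ℂ) ^ q / q.factorial
  have hL : Summable fun r => ‖L r‖ := by
    have h := (summable_correlationBound α 0 x y).comp_injective
      (i := fun r : ℕ × ℕ × ℕ => (0, r)) (Prod.mk_right_injective 0)
    refine Summable.of_nonneg_of_le (fun _ => norm_nonneg _) (fun r => ?_) h
    refine le_trans ?_ (norm_correlationCoeff_mul_le α 0 x y (0, r))
    rw [norm_mul]
    refine mul_le_mul_of_nonneg_left ?_ (norm_nonneg _)
    have : (1 : ℝ) ≤ 2 ^ (α + r.1 + r.2.1 + r.2.2 + 1) := one_le_pow₀ (by norm_num)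
    split_ifs
    · simpa using this
    · simp
  have hE : Summable fun q => ‖E q‖ := NormedSpace.norm_expSeries_div_summable (c : ℂ)
  have h1 : ∀ p : ℕ × ℕ × ℕ × ℕ, correlationCoeff α c x y p * (if p.2.2.2 = 0 then 1 else 0) =
      E p.1 * L p.2 := by
    rintro ⟨q, a, b, e⟩
    simp only [L, E, correlationCoeff, pow_zero, one_mul, Nat.factorial_zero, Nat.cast_one,
      div_eq_mul_inv, mul_inv]
    ring
  have h2 : ∑' q, E q = Complex.exp c := by
    rw [Complex.exp_eq_exp_ℂ, NormedSpace.exp_eq_tsum_div]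
  have h3 : ∑' r, L r = ((besselKernelSeries α x y : ℝ) : ℂ) := by
    -- The swap is needed because a is the exponent of y and b that of x.
    have hinj : Function.Injective fun p : ℕ × ℕ => (p.2, p.1, 0) := by
      rintro ⟨a, b⟩ ⟨a', b'⟩ h
      simp only [Prod.mk.injEq, and_true] at h
      simp [h.1, h.2]
    rw [besselKernelSeries, Complex.ofReal_tsum, ← hinj.tsum_eq (f := L)]
    · refine tsum_congr fun p => ?_
      simp only [L, correlationCoeff, besselCoeff]
      rw [neg_pow (x : ℂ), neg_pow (y : ℂ)]
      push_cast
      simp only [pow_zero, Nat.factorial_zero, Nat.cast_one, add_zero, div_eq_mul_inv,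
        mul_inv, add_comm p.1 α, add_comm p.2 α, add_right_comm _ (p.1 : ℂ) (p.2 : ℂ)]
      ring
    · rintro ⟨a, b, e⟩ h
      rcases Nat.eq_zero_or_pos e with rfl | he
      · exact ⟨(b, a), rfl⟩
      · simp [L, he.ne'] at h
  simp only [h1]
  rw [← tsum_mul_tsum_of_summable_norm hE hL, h2, h3]
  push_cast
  rfl

end Asymptotics

/-! ### The Bessel kernel as a double power series. -/

section Bessel

theorem abs_besselCoeff_le (α k : ℕ) : |besselCoeff α k| ≤ 1 / k.factorial := by
  have h1 : (0 : ℝ) < k.factorial := by positivity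
  have h2 : (1 : ℝ) ≤ (k + α).factorial := by exact_mod_cast (k + α).factorial_pos
  rw [besselCoeff, abs_div, abs_pow, abs_neg, abs_one, one_pow, abs_of_pos (by positivity)]
  exact one_div_le_one_div_of_le h1 (le_mul_of_one_le_right h1.le h2)

/-- Bessel's differential equation at the level of coefficients. -/
theorem besselCoeff_succ (α k : ℕ) :
    besselCoeff α k = -((k + 1) * (k + 1 + α) * besselCoeff α (k + 1)) := by
  have h1 : (k.factorial : ℝ) ≠ 0 := by positivity
  have h2 : ((k + α).factorial : ℝ) ≠ 0 := by positivity
  have h3 : (k : ℝ) + 1 ≠ 0 := by positivity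
  have h4 : (k : ℝ) + 1 + α ≠ 0 := by positivity
  rw [besselCoeff, besselCoeff, show k + 1 + α = (k + α) + 1 by omega, Nat.factorial_succ,
    Nat.factorial_succ]
  push_cast
  rw [show (k : ℝ) + α + 1 = k + 1 + α by ring, pow_succ]
  field_simp

theorem summable_abs_besselCoeff (α : ℕ) (z : ℝ) :
    Summable fun k => |besselCoeff α k * z ^ k| := by
  refine Summable.of_nonneg_of_le (fun _ => abs_nonneg _) (fun k => ?_)
    (Real.summable_pow_div_factorial |z|)
  rw [abs_mul, abs_pow, ← one_div_mul_eq_div]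
  exact mul_le_mul_of_nonneg_right (abs_besselCoeff_le α k) (by positivity)

theorem summable_abs_nat_mul_besselCoeff (α : ℕ) (z : ℝ) :
    Summable fun k => |k * (besselCoeff α k * z ^ k)| := by
  refine Summable.of_nonneg_of_le (fun _ => abs_nonneg _) (fun k => ?_)
    (summable_abs_besselCoeff α (2 * z))
  rw [mul_pow, abs_mul, abs_mul, abs_mul, abs_mul, Nat.abs_cast, abs_of_pos (a := (2 : ℝ) ^ k)
    (by positivity)]
  have : (k : ℝ) ≤ 2 ^ k := by exact_mod_cast Nat.lt_two_pow_self.le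
  calc _ ≤ (2 : ℝ) ^ k * (|besselCoeff α k| * |z ^ k|) := by gcongr
    _ = _ := by ring

theorem besselJ_two_mul (α : ℕ) (u : ℝ) :
    besselJ α (2 * u) = u ^ α * ∑' k, besselCoeff α k * (u ^ 2) ^ k := by
  rw [besselJ, ← tsum_mul_left]
  refine tsum_congr fun k => ?_
  rw [mul_div_cancel_left₀ _ two_ne_zero, besselCoeff, pow_add, pow_mul]
  ring

theorem hasDerivAt_besselJ (α : ℕ) (t : ℝ) :
    HasDerivAt (besselJ α)
      (∑' k, besselCoeff α k * (((2 * k + α : ℕ) : ℝ) * (t / 2) ^ (2 * k + α - 1) * (1 / 2))) t := by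
  set M : ℝ := |t| + 1 with hM
  have hM1 : 1 ≤ M := by simp [hM]
  -- With n = 2k + α, the bound uses n ≤ 2^n and M^(n−1) ≤ M^n, valid as M ≥ 1. The truncated
  -- exponent at n = 0 is harmless, its coefficient being zero.
  refine hasDerivAt_tsum_of_isPreconnected (t := Metric.ball 0 M)
    (u := fun k => (2 * M) ^ α * (((2 * M) ^ 2) ^ k / k.factorial))
    (g := fun k y => besselCoeff α k * (y / 2) ^ (2 * k + α))
    (g' := fun k y => besselCoeff α k *
      (((2 * k + α : ℕ) : ℝ) * (y / 2) ^ (2 * k + α - 1) * (1 / 2))) (y₀ := 0)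
    ((Real.summable_pow_div_factorial _).mul_left _) Metric.isOpen_ball
    (convex_ball _ _).isPreconnected ?_ ?_ (by simp; linarith) ?_ (by simp [hM])
  · intro k y _
    exact (((hasDerivAt_id y).div_const 2).pow (2 * k + α)).const_mul _
  · intro k y hy
    rw [Metric.mem_ball, dist_zero_right, Real.norm_eq_abs] at hy
    rw [Real.norm_eq_abs, abs_mul, abs_mul, abs_mul, Nat.abs_cast, abs_pow, abs_div]
    have h1 : (|y| / |(2 : ℝ)|) ^ (2 * k + α - 1) ≤ M ^ (2 * k + α) := by
      have : |y| / |(2 : ℝ)| ≤ M := by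
        rw [abs_two]
        have := abs_nonneg y
        linarith
      calc _ ≤ M ^ (2 * k + α - 1) := by gcongr
        _ ≤ _ := pow_le_pow_right₀ hM1 (Nat.sub_le _ _)
    have h2 : ((2 * k + α : ℕ) : ℝ) ≤ 2 ^ (2 * k + α) := by
      exact_mod_cast Nat.lt_two_pow_self.le
    have h3 : |(1 / 2 : ℝ)| ≤ 1 := by rw [abs_of_pos] <;> norm_num
    calc _ ≤ 1 / (k.factorial : ℝ) * (2 ^ (2 * k + α) * M ^ (2 * k + α) * 1) := by
          gcongr
          exact abs_besselCoeff_le α k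
      _ = _ := by
          rw [← mul_pow, pow_add, pow_mul]
          ring
  · have := (summable_abs_besselCoeff α 0).of_abs.mul_left ((0 : ℝ) ^ α)
    refine this.congr fun k => ?_
    rw [zero_div, pow_add, pow_mul, zero_pow two_ne_zero]
    ring

/-- The Euler operator t d/dt multiplies the term of degree 2k + α by 2k + α; no division by u is
needed. -/
theorem two_mul_deriv_besselJ (α : ℕ) (u : ℝ) :
    2 * u * deriv (besselJ α) (2 * u) =
      u ^ α * (2 * ∑' k, k * (besselCoeff α k * (u ^ 2) ^ k) +
        α * ∑' k, besselCoeff α k * (u ^ 2) ^ k) := by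
  rw [(hasDerivAt_besselJ α _).deriv, ← tsum_mul_left, ← tsum_mul_left, ← tsum_mul_left,
    ← ((summable_abs_nat_mul_besselCoeff α _).of_abs.mul_left _).tsum_add
      ((summable_abs_besselCoeff α _).of_abs.mul_left _), ← tsum_mul_left]
  refine tsum_congr fun k => ?_
  rw [mul_div_cancel_left₀ _ two_ne_zero]
  have h : ((2 * k + α : ℕ) : ℝ) * (u ^ (2 * k + α - 1) * u) =
      ((2 * k + α : ℕ) : ℝ) * (u ^ α * (u ^ 2) ^ k) := by
    rw [← pow_mul, ← pow_add, add_comm α]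
    rcases Nat.eq_zero_or_pos (2 * k + α) with h0 | h0
    · simp [h0]
    · rw [← pow_succ, Nat.sub_add_cancel h0]
  push_cast at h ⊢
  linear_combination besselCoeff α k * h

/-- The term of the double series `z * besselKernelSeries α z w`, up to an index shift. -/
noncomputable def besselShiftTerm (α : ℕ) (z w : ℝ) (p : ℕ × ℕ) : ℝ :=
  p.1 * (p.1 + α) / (α + p.1 + p.2) * (besselCoeff α p.1 * z ^ p.1 * (besselCoeff α p.2 * w ^ p.2))

theorem summable_besselShiftTerm (α : ℕ) (z w : ℝ) : Summable (besselShiftTerm α z w) := by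
  have ts := (summable_abs_nat_mul_besselCoeff α z).mul_of_nonneg (summable_abs_besselCoeff α w)
    (fun _ => abs_nonneg _) (fun _ => abs_nonneg _)
  refine Summable.of_norm_bounded ts fun p => ?_
  have hratio : |(p.1 : ℝ) * (p.1 + α) / (α + p.1 + p.2)| ≤ p.1 := by
    rw [abs_of_nonneg (by positivity), mul_div_assoc]
    have : ((p.1 : ℝ) + α) / (α + p.1 + p.2) ≤ 1 := by
      refine div_le_one_of_le₀ ?_ (by positivity)
      have : (0 : ℝ) ≤ p.2 := by positivity
      linarith
    exact mul_le_of_le_one_right (by positivity) this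
  rw [besselShiftTerm, Real.norm_eq_abs, abs_mul, abs_mul (_ * _) (_ * _), abs_mul (p.1 : ℝ),
    Nat.abs_cast, mul_assoc (p.1 : ℝ)]
  exact mul_le_mul_of_nonneg_right hratio (by positivity)

/-- The factor z raises the first index, and the recurrence restores the matching coefficient. The
shifted series has no new terms, since its index-0 terms vanish. -/
theorem mul_besselKernelSeries (α : ℕ) (z w : ℝ) :
    z * besselKernelSeries α z w = -∑' p, besselShiftTerm α z w p := by
  have hinj : Function.Injective fun p : ℕ × ℕ => (p.1 + 1, p.2) := by
    rintro ⟨a, b⟩ ⟨a', b'⟩ h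
    simpa using h
  rw [besselKernelSeries, ← tsum_mul_left, ← hinj.tsum_eq (f := besselShiftTerm α z w), ← tsum_neg]
  · refine tsum_congr fun p => ?_
    rw [besselShiftTerm, besselCoeff_succ α p.1]
    push_cast
    rw [show (α : ℝ) + (p.1 + 1) + p.2 = α + p.1 + p.2 + 1 by ring]
    ring
  · rintro ⟨a, b⟩ h
    rcases a with _ | a
    · simp [besselShiftTerm] at h
    · exact ⟨(a, b), rfl⟩

theorem besselKernelSeries_comm (α : ℕ) (z w : ℝ) :
    besselKernelSeries α z w = besselKernelSeries α w z := by
  rw [besselKernelSeries, besselKernelSeries, ← (Equiv.prodComm ℕ ℕ).tsum_eq]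
  refine tsum_congr fun p => ?_
  simp only [Equiv.prodComm_apply, Prod.fst_swap, Prod.snd_swap]
  rw [mul_comm, add_right_comm (α : ℝ)]

/-- The Christoffel–Darboux type identity for the Bessel power series. -/
theorem bessel_wronskian_eq (α : ℕ) (z w : ℝ) :
    (∑' k, besselCoeff α k * z ^ k) * (∑' k, k * (besselCoeff α k * w ^ k)) -
      (∑' k, k * (besselCoeff α k * z ^ k)) * (∑' k, besselCoeff α k * w ^ k) =
    (z - w) * besselKernelSeries α z w := by
  have sz : Summable fun k => ‖besselCoeff α k * z ^ k‖ := summable_abs_besselCoeff α z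
  have sw : Summable fun k => ‖besselCoeff α k * w ^ k‖ := summable_abs_besselCoeff α w
  have tz : Summable fun k : ℕ => ‖k * (besselCoeff α k * z ^ k)‖ :=
    summable_abs_nat_mul_besselCoeff α z
  have tw : Summable fun k : ℕ => ‖k * (besselCoeff α k * w ^ k)‖ :=
    summable_abs_nat_mul_besselCoeff α w
  have hsw := (Equiv.prodComm ℕ ℕ).summable_iff.2 (summable_besselShiftTerm α w z)
  rw [sub_mul, mul_besselKernelSeries, besselKernelSeries_comm α z w, mul_besselKernelSeries,
    neg_sub_neg, ← (Equiv.prodComm ℕ ℕ).tsum_eq (besselShiftTerm α w z),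
    tsum_mul_tsum_of_summable_norm sz tw, tsum_mul_tsum_of_summable_norm tz sw,
    ← (summable_mul_of_summable_norm sz tw).tsum_sub (summable_mul_of_summable_norm tz sw)]
  refine Eq.trans ?_ (hsw.tsum_sub (summable_besselShiftTerm α z w))
  refine tsum_congr fun p => ?_
  simp only [besselShiftTerm, Function.comp, Equiv.prodComm_apply, Prod.fst_swap, Prod.snd_swap]
  -- Termwise the identity is k(k+α) − j(j+α) = (k−j)(α+j+k), divided by α+j+k. That divisor
  -- vanishes only at α = j = k = 0, where both sides are zero.
  rcases eq_or_ne ((α : ℝ) + p.1 + p.2) 0 with h | h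
  · have h' : α + p.1 + p.2 = 0 := by exact_mod_cast h
    have h1 : p.1 = 0 := by omega
    have h2 : p.2 = 0 := by omega
    simp [h1, h2]
  · rw [add_right_comm (α : ℝ) p.2 p.1]
    generalize besselCoeff α p.1 * z ^ p.1 = A
    generalize besselCoeff α p.2 * w ^ p.2 = B
    field_simp
    ring

theorem continuous_besselKernelSeries (α : ℕ) :
    Continuous fun p : ℝ × ℝ => besselKernelSeries α p.1 p.2 := by
  rw [continuous_iff_continuousAt]
  intro p₀
  set M : ℝ := ‖p₀‖ + 1 with hM
  have hball : Metric.ball (0 : ℝ × ℝ) M ∈ 𝓝 p₀ :=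
    Metric.isOpen_ball.mem_nhds (by simp [hM])
  refine ContinuousOn.continuousAt ?_ hball
  have hs := (Real.summable_pow_div_factorial M).mul_of_nonneg (Real.summable_pow_div_factorial M)
    (fun _ => by positivity) (fun _ => by positivity)
  unfold besselKernelSeries
  refine continuousOn_tsum (fun r => by fun_prop) hs fun r p hp => ?_
  rw [mem_ball_zero_iff] at hp
  have h1 : |p.1| ≤ M := (norm_fst_le p).trans hp.le
  have h2 : |p.2| ≤ M := (norm_snd_le p).trans hp.le
  have h3 : (1 : ℝ) ≤ α + r.1 + r.2 + 1 := by
    have : (0 : ℝ) ≤ α + r.1 + r.2 := by positivity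
    linarith
  rw [norm_div, Real.norm_of_nonneg (zero_le_one.trans h3), Real.norm_eq_abs]
  refine (div_le_self (abs_nonneg _) h3).trans ?_
  rw [abs_mul, abs_mul, abs_mul, abs_pow, abs_pow]
  calc _ ≤ 1 / (r.1.factorial : ℝ) * M ^ r.1 * (1 / r.2.factorial * M ^ r.2) := by
        gcongr
        · exact abs_besselCoeff_le α _
        · exact abs_besselCoeff_le α _
    _ = _ := by ring

/-- In the antisymmetric combination the α-parts of the two Euler derivatives cancel, leaving twice
the expression in `bessel_wronskian_eq`. -/
theorem besselKernelQuotient_eq (α : ℕ) {x y : ℝ} (hx : 0 ≤ x) (hy : 0 ≤ y) (hxy : x ≠ y) :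
    besselKernelQuotient α x y =
      1 / 4 * (√x / 2 * (√y / 2)) ^ α * besselKernelSeries α (x / 4) (y / 4) := by
  have hu : (√x / 2) ^ 2 = x / 4 := by rw [div_pow, Real.sq_sqrt hx]; norm_num
  have hv : (√y / 2) ^ 2 = y / 4 := by rw [div_pow, Real.sq_sqrt hy]; norm_num
  have j1 := besselJ_two_mul α (√x / 2)
  have j2 := besselJ_two_mul α (√y / 2)
  have d1 := two_mul_deriv_besselJ α (√x / 2)
  have d2 := two_mul_deriv_besselJ α (√y / 2)
  rw [mul_div_cancel₀ _ two_ne_zero, hu] at j1 d1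
  rw [mul_div_cancel₀ _ two_ne_zero, hv] at j2 d2
  have hW := bessel_wronskian_eq α (x / 4) (y / 4)
  have h0 : 2 * (x - y) ≠ 0 := mul_ne_zero two_ne_zero (sub_ne_zero.2 hxy)
  rw [besselKernelQuotient, div_eq_iff h0, j1, j2, d1, d2, mul_pow]
  linear_combination 2 * ((√x / 2) ^ α * (√y / 2) ^ α) * hW

/-- On the diagonal both sides are limits of their off-diagonal values along (x + 1/(n+1), x), the
right one by continuity of the series. -/
theorem besselKernel_eq (α : ℕ) {x y : ℝ} (hx : 0 < x) (hy : 0 < y) :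
    besselKernel α x y =
      1 / 4 * (√x / 2 * (√y / 2)) ^ α * besselKernelSeries α (x / 4) (y / 4) := by
  rcases eq_or_ne x y with rfl | hxy
  · have hp : Tendsto (fun n : ℕ => (x + 1 / ((n : ℝ) + 1), x)) atTop
        (𝓝[{p : ℝ × ℝ | p.1 ≠ p.2}] (x, x)) := by
      refine tendsto_nhdsWithin_iff.2 ⟨?_, Eventually.of_forall fun n => ?_⟩
      · have := (tendsto_one_div_add_atTop_nhds_zero_nat (𝕜 := ℝ)).const_add x
        rw [add_zero] at this
        exact this.prodMk_nhds tendsto_const_nhds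
      · have : (0 : ℝ) < 1 / ((n : ℝ) + 1) := by positivity
        simp only [Set.mem_ofPred_eq]
        linarith
    have h1 := (tendsto_besselKernelQuotient α hx).comp hp
    have hc : Continuous fun p : ℝ × ℝ =>
        1 / 4 * (√p.1 / 2 * (√p.2 / 2)) ^ α * besselKernelSeries α (p.1 / 4) (p.2 / 4) := by
      have := (continuous_besselKernelSeries α).comp
        (show Continuous fun p : ℝ × ℝ => (p.1 / 4, p.2 / 4) by fun_prop)
      exact Continuous.mul (by fun_prop) this
    have h2 := (hc.tendsto (x, x)).comp (hp.mono_right nhdsWithin_le_nhds)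
    refine tendsto_nhds_unique h1 (h2.congr fun n => ?_)
    have : (0 : ℝ) < 1 / ((n : ℝ) + 1) := by positivity
    exact (besselKernelQuotient_eq α (by positivity) hx.le (by linarith)).symm
  · rw [besselKernel, if_neg hxy, besselKernelQuotient_eq α hx.le hy.le hxy]

end Bessel

/-! ### Scaling factor and conclusion. -/

theorem scalingZ_eq (α N : ℕ) {μ ν : ℝ} (hμ : 0 < μ) (hν : 0 < ν) :
    scalingZ α N (μ / 4) (ν / 4) = (√μ / 2 * (√ν / 2)) ^ α / (N : ℝ) ^ α := by
  have h : μ / 4 * (ν / 4) / (N : ℝ) ^ 2 = (√μ / 2 * (√ν / 2) / N) ^ 2 := by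
    rw [div_pow, mul_pow, div_pow, div_pow, Real.sq_sqrt hμ.le, Real.sq_sqrt hν.le]
    norm_num
  have h0 : 0 ≤ √μ / 2 * (√ν / 2) / N := by positivity
  rw [scalingZ, h, ← div_pow, ← Real.rpow_natCast _ 2, ← Real.rpow_mul h0, ← Real.rpow_natCast]
  congr 1
  push_cast
  ring

theorem theorem6p1
    (Q : Measure ℝ) [IsProbabilityMeasure Q] (hQ : MemLp (fun x : ℝ => x) 4 Q)
    (hmean : ∫ x, x ∂Q = 0) (hvar : ∫ x, x ^ 2 ∂Q = 1 / 2)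
    (b : ℝ) (hb : ∫ x, x ^ 4 ∂Q = b)
    (α : ℕ)
    {Ω : ℕ → Type*} [∀ N, MeasurableSpace (Ω N)]
    (P : (N : ℕ) → Measure (Ω N)) [∀ N, IsProbabilityMeasure (P N)]
    (X : (N : ℕ) → Ω N → Matrix (Fin N) (Fin (N - α)) ℂ)
    (hX : ∀ N, IsComplexSampleMatrix (P N) Q (X N))
    (μ ν : ℝ) (hμ : 0 < μ) (hν : 0 < ν) :
    (∀ (N : ℕ) (z w : ℂ), Integrable (charPolyProduct (X N) z w) (P N)) ∧
    Tendsto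
      (fun N : ℕ =>
        (((1 / 4 : ℝ) * (N : ℝ)⁻¹ * scalingZ α N (μ / 4) (ν / 4) : ℝ) : ℂ) *
          (secondOrderCorrelation (P N) (X N) ((μ / (4 * N) : ℝ) : ℂ) ((ν / (4 * N) : ℝ) : ℂ) /
            ((N.factorial : ℂ) * ((N - α).factorial : ℂ))))
      atTop
      (𝓝 ((Real.exp (2 * (b - 3 / 4)) * besselKernel α μ ν : ℝ) : ℂ)) := by
  have hlaw := isEntryLaw_complexLaw hQ hmean hvar hb
  refine ⟨fun N z w => integrable_charPolyProduct (hX N) hlaw z w, ?_⟩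
  -- The arguments μ/(4N), ν/(4N) are x/N, y/N with x = μ/4, y = ν/4. The division by N^(α+1) comes
  -- from N⁻¹ and the N^(−α) inside `scalingZ`.
  have h := (tendsto_tsum_correlationTerm α ((2 * (b - 3 / 4) : ℝ) : ℂ) ((μ / 4 : ℝ) : ℂ)
    ((ν / 4 : ℝ) : ℂ)).const_mul (((1 / 4 * (√μ / 2 * (√ν / 2)) ^ α : ℝ)) : ℂ)
  rw [tsum_correlationCoeff, ← Complex.ofReal_mul] at h
  have hlim : 1 / 4 * (√μ / 2 * (√ν / 2)) ^ α *
      (Real.exp (2 * (b - 3 / 4)) * besselKernelSeries α (μ / 4) (ν / 4)) =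
      Real.exp (2 * (b - 3 / 4)) * besselKernel α μ ν := by
    rw [besselKernel_eq α hμ hν]
    ring
  rw [hlim] at h
  refine h.congr' ?_
  -- For N < α the truncated N − α is 0 and N = (N − α) + α fails.
  filter_upwards [eventually_ge_atTop α] with N hN
  rw [secondOrderCorrelation_div_eq_tsum (α := α) (by omega) (hX N) hlaw, scalingZ_eq α N hμ hν]
  rw [show ((μ / (4 * N) : ℝ) : ℂ) = ((μ / 4 : ℝ) : ℂ) / N by push_cast; rw [div_div],
    show ((ν / (4 * N) : ℝ) : ℂ) = ((ν / 4 : ℝ) : ℂ) / N by push_cast; rw [div_div]]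
  generalize ∑' p, correlationTerm α N ((2 * (b - 3 / 4) : ℝ) : ℂ) (((μ / 4 : ℝ) : ℂ) / N)
    (((ν / 4 : ℝ) : ℂ) / N) p = A
  push_cast
  rw [pow_succ]
  simp only [div_eq_mul_inv, mul_inv]
  ring
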